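/- Let $\Gamma$ be a non-elementary (i.e. not virtually cyclic) torsion-free hyperbolic group. A variety over $\Gamma$ is a set $V\subset\Gamma^d$ of common solutions of a (possibly infinite) system of equations $w(x_1,\dots,x_d)=1$ with $w\in\Gamma*\langle x_1,\dots,x_d\rangle$. Its coordinate group (group of functions) $L_V$ is the group, under pointwise multiplication, of the word maps $V\to\Gamma$, $v\mapsto w(v)$, for $w\in\Gamma*\langle x_1,\dots,x_d\rangle$; when $V\neq\emptyset$, $\Gamma$ is identified with the subgroup of $L_V$ formed by the constant maps. A non-empty variety is irreducible if it is not a finite union of proper subvarieties. An algebraic automorphism of $V$ is a bijection $V\to V$ such that the coordinates of it and of its inverse are word maps, and $V$ is homogeneous if its algebraic automorphisms act transitively on it. A Grushko decomposition of $L_V$ relative to $\Gamma$ is a free product decomposition $$L_V=L_V^0*G_1*\dots*G_n*\mathbb{F}_r\qquad (n,r\ge 0)$$ such that $\Gamma\subset L_V^0$, the group $L_V^0$ is freely indecomposable relative to $\Gamma$ (if $L_V^0=A*B$ with $\Gamma\subset A$, then $B=1$), each $G_i$ is nontrivial, freely indecomposable and not infinite cyclic, and $\mathbb{F}_r$ is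 free of rank $r$. Proposition. Let $V$ be a homogeneous irreducible variety over $\Gamma$. Then $L_V$ has a Grushko decomposition relative to $\Gamma$, and every such decomposition satisfies $n=0$, i.e. it has the form $L_V=L_V^0*\mathbb{F}_r$ with $\Gamma\subset L_V^0$. Moreover, for every such decomposition, $L_V^0$ is the coordinate group of a homogeneous irreducible variety over $\Gamma$: there are $d'\ge 0$, a homogeneous irreducible variety $W\subset\Gamma^{d'}$ and a group isomorphism $L_V^0\to L_W$ which is the identity on $\Gamma$. -/

import Mathlib

namespace GroupVar

/-! ### Hyperbolic groups -/

/-- The word metric on `Γ` for a set `S` (meant to be generating): the graph distance between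
vertices of the Cayley graph. -/
noncomputable def wordDist {Γ : Type*} [Group Γ] (S : Set Γ) (g h : Γ) : ℕ :=
  (SimpleGraph.mulCayley S).dist g h

/-- A group is (Gromov) hyperbolic if it has a finite generating set whose word metric satisfies
Gromov's four point condition for some `δ`. -/
def IsHyperbolic (Γ : Type*) [Group Γ] : Prop :=
  ∃ S : Finset Γ, Subgroup.closure (S : Set Γ) = ⊤ ∧ ∃ δ : ℕ, ∀ x y z w : Γ,
    wordDist (S : Set Γ) x y + wordDist (S : Set Γ) z w ≤
      max (wordDist (S : Set Γ) x z + wordDist (S : Set Γ) y w)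
        (wordDist (S : Set Γ) x w + wordDist (S : Set Γ) y z) + 2 * δ

/-- A group is elementary if it is virtually cyclic. -/
def IsElementary (Γ : Type*) [Group Γ] : Prop :=
  ∃ C : Subgroup Γ, IsCyclic C ∧ C.FiniteIndex

/-- Torsion-free: no nontrivial element has finite order. -/
def IsTorsionFreeGroup (Γ : Type*) [Group Γ] : Prop :=
  ∀ g : Γ, g ≠ 1 → ¬ IsOfFinOrder g

/-! ### Varieties over a group -/

/-- `Γ`-words in the variables `x₁, …, x_d`: the free product `Γ * ⟨x₁, …, x_d⟩`. -/
abbrev Words (Γ : Type*) [Group Γ] (d : ℕ) : Type _ :=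
  Monoid.Coprod Γ (FreeGroup (Fin d))

/-- The evaluation `w ↦ w(v₁, …, v_d)`, the identity on `Γ`. -/
def evalAt {Γ : Type*} [Group Γ] {d : ℕ} (v : Fin d → Γ) : Words Γ d →* Γ :=
  Monoid.Coprod.lift (MonoidHom.id Γ) (FreeGroup.lift v)

/-- The variety defined by a (possibly infinite) system of equations. -/
def varietyOf {Γ : Type*} [Group Γ] {d : ℕ} (E : Set (Words Γ d)) : Set (Fin d → Γ) :=
  {v | ∀ w ∈ E, evalAt v w = 1}

/-- A subset of `Γ^d` is a variety if it is defined by some system of equations over `Γ`. -/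
def IsVariety {Γ : Type*} [Group Γ] {d : ℕ} (V : Set (Fin d → Γ)) : Prop :=
  ∃ E : Set (Words Γ d), V = varietyOf E

/-- A non-empty variety is irreducible if it is not a finite union of proper subvarieties. -/
def IsIrreducibleVariety {Γ : Type*} [Group Γ] {d : ℕ} (V : Set (Fin d → Γ)) : Prop :=
  IsVariety V ∧ V.Nonempty ∧
    ¬ ∃ (n : ℕ) (W : Fin n → Set (Fin d → Γ)),
      (∀ i, IsVariety (W i) ∧ W i ⊂ V) ∧ V = ⋃ i, W i

/-- Algebraic maps: the coordinates are given by word maps. -/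
def IsAlgebraicMap {Γ : Type*} [Group Γ] {d d' : ℕ} {V : Set (Fin d → Γ)}
    {V' : Set (Fin d' → Γ)} (F : V → V') : Prop :=
  ∃ w : Fin d' → Words Γ d, ∀ (v : V) (j : Fin d'), (F v : Fin d' → Γ) j = evalAt (v : Fin d → Γ) (w j)

/-- `V` is homogeneous if its group of algebraic automorphisms acts transitively on it. -/
def IsHomogeneous {Γ : Type*} [Group Γ] {d : ℕ} (V : Set (Fin d → Γ)) : Prop :=
  ∀ x y : V, ∃ F : V ≃ V, IsAlgebraicMap (F : V → V) ∧ IsAlgebraicMap (F.symm : V → V) ∧ F x = y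

/-- The homomorphism which sends a word to the word map it defines on `V`. -/
def wordMap {Γ : Type*} [Group Γ] {d : ℕ} (V : Set (Fin d → Γ)) : Words Γ d →* (V → Γ) :=
  MonoidHom.pi fun v : V => evalAt (v : Fin d → Γ)

/-- The group of functions (coordinate group) `L_V`: word maps `V → Γ`, with pointwise product. -/
abbrev functionGroup {Γ : Type*} [Group Γ] {d : ℕ} (V : Set (Fin d → Γ)) : Subgroup (V → Γ) :=
  (wordMap V).range

/-- The map `Γ → L_V` sending an element to the corresponding constant function. -/
def constFun {Γ : Type*} [Group Γ] {d : ℕ} (V : Set (Fin d → Γ)) : Γ →* functionGroup V :=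
  (wordMap V).rangeRestrict.comp Monoid.Coprod.inl

theorem constFun_apply {Γ : Type*} [Group Γ] {d : ℕ} (V : Set (Fin d → Γ)) (γ : Γ) (v : V) :
    (constFun V γ : V → Γ) v = γ := by
  change evalAt (v : Fin d → Γ) (Monoid.Coprod.inl γ) = γ
  simp [evalAt]

/-- The copy of `Γ` in `L_V` formed by the constant functions. -/
abbrev constants {Γ : Type*} [Group Γ] {d : ℕ} (V : Set (Fin d → Γ)) :
    Subgroup (functionGroup V) :=
  (constFun V).range

/-! ### Free product decompositions -/

/-- `L = A * B` as an internal free product. -/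
def IsFreeProduct {L : Type*} [Group L] (A B : Subgroup L) : Prop :=
  Function.Bijective (Monoid.Coprod.lift A.subtype B.subtype)

/-- `L` is freely indecomposable relative to a subgroup `H`: there is no nontrivial decomposition
`L = A * B` with `H ⊆ A`. -/
def FreelyIndecomposableRel {L : Type*} [Group L] (H : Subgroup L) : Prop :=
  ∀ A B : Subgroup L, IsFreeProduct A B → H ≤ A → A = ⊥ ∨ B = ⊥

/-- `L` is freely indecomposable: there is no nontrivial decomposition `L = A * B`. -/
def FreelyIndecomposable (L : Type*) [Group L] : Prop :=
  ∀ A B : Subgroup L, IsFreeProduct A B → A = ⊥ ∨ B = ⊥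

/-- `L = L₀ * 𝔽_r` as an internal free product, with `t` a basis of the free factor `𝔽_r`. -/
def IsFreeProductWithFree {L : Type*} [Group L] (L₀ : Subgroup L) {r : ℕ} (t : Fin r → L) : Prop :=
  Function.Bijective (Monoid.Coprod.lift L₀.subtype (FreeGroup.lift t))

/-- `L = L₀ * G₁ * ⋯ * Gₙ * 𝔽_r` (internal free product, `t` being a basis of the free factor
`𝔽_r`) is a Grushko decomposition of `L` relative to the subgroup `H`, with `H ⊆ L₀`: `L₀` is
freely indecomposable relative to `H`, and each `Gᵢ` is nontrivial, not infinite cyclic, and freely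
indecomposable. -/
structure IsGrushkoDecomposition {L : Type*} [Group L] (H : Subgroup L) (L₀ : Subgroup L) {n : ℕ}
    (G : Fin n → Subgroup L) {r : ℕ} (t : Fin r → L) : Prop where
  bijective : Function.Bijective
    (Monoid.Coprod.lift
      (Monoid.Coprod.lift L₀.subtype (Monoid.CoprodI.lift fun i => (G i).subtype))
      (FreeGroup.lift t))
  le : H ≤ L₀
  indecomposable_base : FreelyIndecomposableRel (H.subgroupOf L₀)
  nontrivial : ∀ i, Nontrivial (G i)
  not_infinite_cyclic : ∀ i, ¬ Nonempty (G i ≃* Multiplicative ℤ)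
  indecomposable : ∀ i, FreelyIndecomposable (G i)

end GroupVar

-- Put L = L_V. Evaluation identifies the points of V with the homomorphisms L → Γ that are the
-- identity on Γ (`exists_eq_evalPoint`), and the points separate the elements of L. Algebraic
-- automorphisms of V act on L by composition, so homogeneity makes the automorphisms of L over Γ
-- permute these homomorphisms transitively (`IsHomogeneous.exists_mulEquiv`).
--
-- Suppose a factor G_i is present. Take g ≠ 1 in it, a point v with g(v) ≠ 1, and the endomorphism
-- ρ of L that is the identity on L⁰ and kills the other factors. Then ev_v ∘ ρ = ev_{v'} for some
-- point v', and ev_{v'} ∘ α = ev_v for some automorphism α over Γ. But α(G_i) is conjugate into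
-- some G_j, which ev_{v'} kills, so g(v) = 1, a contradiction. Likewise α preserves L⁰. As every
-- homomorphism L⁰ → Γ over Γ extends to L through the retraction onto L⁰, transitivity descends to
-- L⁰. These homomorphisms are the points of W, and a finite cover of W by proper subvarieties would
-- pull back to one of V.
--
-- The rigidity of the factors (`map_mem`, `map_eq_one`) rests on two parts of Kurosh's theorem: the
-- intersection of a subgroup H with a free factor is a free factor of H
-- (`exists_isFreeProduct_subgroupOf`), and H is free if it meets all conjugates of the factors
-- trivially (`isFreeGroup_of_forall_conj`). Both are proved by extending cocycles over L ⧸ H from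
-- the factors to L.
--
-- For existence, L is finitely generated and torsion-free, so nontrivial factors are infinite, and
-- a group with m generators is a free product of at most m infinite groups
-- (`IsFreeFamily.card_le`). A decomposition with the largest number of factors is then a Grushko
-- decomposition. This weak form of Grushko's theorem is an ℓ² argument: n infinite factors yield a
-- derivation whose values on the m generators form a jointly injective equivariant family ℓ²(L)ⁿ →
-- ℓ²(L), and von Neumann dimension gives n ≤ m.

universe u

namespace GroupVar

open Monoid

/-! ### Internal free products of families of subgroups -/

/-- `L` is the internal free product of the subgroups `A i`: they generate `L`, and homomorphisms
defined on the `A i` extend to `L`. -/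
structure IsFreeFamily {L : Type u} [Group L] {ι : Type*} (A : ι → Subgroup L) : Prop where
  iSup_eq_top : ⨆ i, A i = ⊤
  exists_lift : ∀ {X : Type u} [Group X] (f : ∀ i, A i →* X),
    ∃ F : L →* X, ∀ i (a : A i), F a = f i a

namespace IsFreeFamily

variable {L : Type u} [Group L] {ι : Type*} {A : ι → Subgroup L}

theorem mem_of_forall_le (hA : IsFreeFamily A) {H : Subgroup L} (h : ∀ i, A i ≤ H) (x : L) : x ∈ H := by
  have h1 : ⨆ i, A i ≤ H := iSup_le h
  rw [hA.iSup_eq_top] at h1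
  exact h1 trivial

theorem hom_ext (hA : IsFreeFamily A) {X : Type*} [Group X] {f g : L →* X}
    (h : ∀ i, ∀ a ∈ A i, f a = g a) : f = g := by
  ext x
  exact hA.mem_of_forall_le (H := f.eqLocus g) (fun i a ha => h i a ha) x

/-- Extension of homomorphisms to an internal free product of two subgroups. -/
theorem exists_lift_pair {A B : Subgroup L}
    (hA : IsFreeFamily fun b : Bool => cond b A B) {X : Type u} [Group X] (f : A →* X)
    (g : B →* X) : ∃ F : L →* X, (∀ a : A, F a = f a) ∧ ∀ b : B, F b = g b := by
  obtain ⟨F, hF⟩ := hA.exists_lift (X := X) (fun b => match b with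
    | true => f
    | false => g)
  exact ⟨F, hF true, hF false⟩

theorem mk_pair {A B : Subgroup L} (h1 : A ⊔ B = ⊤)
    (h2 : ∀ {X : Type u} [Group X] (f : A →* X) (g : B →* X),
      ∃ F : L →* X, (∀ a : A, F a = f a) ∧ ∀ b : B, F b = g b) :
    IsFreeFamily fun b : Bool => cond b A B where
  iSup_eq_top := by rw [iSup_bool_eq]; exact h1
  exists_lift f := by
    obtain ⟨F, hF, hF'⟩ := h2 (f true) (f false)
    refine ⟨F, fun b => ?_⟩
    cases b
    · exact hF'
    · exact hF

/-- Injectivity only requires the extension property for the target `Coprod A B`, which lies in the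
universe of `L`; hence restricting the test groups to that universe loses nothing. -/
theorem isFreeProduct_iff {A B : Subgroup L} :
    IsFreeProduct A B ↔ IsFreeFamily fun b : Bool => cond b A B := by
  constructor
  · intro h
    let e := MulEquiv.ofBijective _ h
    apply mk_pair
    · have h1 := (MonoidHom.range_eq_top).2 h.2
      rwa [Coprod.range_lift, Subgroup.range_subtype, Subgroup.range_subtype] at h1
    · intro X _ f g
      refine ⟨(Coprod.lift f g).comp e.symm.toMonoidHom, fun a => ?_, fun b => ?_⟩
      · have : e (Coprod.inl a) = a :=
          Coprod.lift_apply_inl A.subtype B.subtype a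
        simp [← this]
      · have : e (Coprod.inr b) = b :=
          Coprod.lift_apply_inr A.subtype B.subtype b
        simp [← this]
  · intro h
    constructor
    · obtain ⟨F, hF, hF'⟩ := h.exists_lift_pair (Coprod.inl : A →* Coprod A B) Coprod.inr
      have h1 : F.comp (Coprod.lift A.subtype B.subtype) = MonoidHom.id _ :=
        Coprod.hom_ext (MonoidHom.ext fun a => hF a) (MonoidHom.ext fun b => hF' b)
      exact Function.LeftInverse.injective (g := F) fun x => DFunLike.congr_fun h1 x
    · rw [← MonoidHom.range_eq_top, Coprod.range_lift, Subgroup.range_subtype,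
        Subgroup.range_subtype]
      have h1 := h.iSup_eq_top
      rwa [iSup_bool_eq] at h1

theorem isFreeProduct_compl (hA : IsFreeFamily A) (i : ι) :
    IsFreeProduct (A i) (⨆ j ≠ i, A j) := by
  classical
  rw [isFreeProduct_iff]
  have hle : ∀ j, j ≠ i → A j ≤ ⨆ j ≠ i, A j := fun j hj => le_iSup₂_of_le j hj le_rfl
  apply mk_pair
  · rw [eq_top_iff, ← hA.iSup_eq_top]
    refine iSup_le fun j => ?_
    by_cases hj : j = i
    · subst hj
      exact le_sup_left
    · exact (hle j hj).trans le_sup_right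
  · intro X _ f g
    obtain ⟨F, hF⟩ := hA.exists_lift (X := X) (fun j =>
      if hj : j = i then f.comp (Subgroup.inclusion (hj ▸ le_rfl))
      else g.comp (Subgroup.inclusion (hle j hj)))
    refine ⟨F, fun a => ?_, fun b => ?_⟩
    · rw [hF i a, dif_pos rfl]
      rfl
    -- The locus where `F` and `g` agree, pushed into `L`, contains every `A j` with `j ≠ i`, hence
    -- their supremum.
    · let B' : Subgroup L := ((F.comp (⨆ j ≠ i, A j).subtype).eqLocus g).map
        (⨆ j ≠ i, A j).subtype
      have h1 : (⨆ j ≠ i, A j) ≤ B' := by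
        refine iSup₂_le fun j hj a ha => ?_
        refine ⟨⟨a, hle j hj ha⟩, ?_, rfl⟩
        have := hF j ⟨a, ha⟩
        simp only [hj, dite_false] at this
        exact this
      obtain ⟨c, hc, hcb⟩ := h1 b.2
      have : c = b := Subtype.ext hcb
      subst this
      exact hc

/-- Extend one homomorphism by the trivial one on the other factors. -/
theorem exists_lift_single (hA : IsFreeFamily A) {X : Type u} [Group X] (i : ι) (f : A i →* X) :
    ∃ F : L →* X, (∀ a : A i, F a = f a) ∧ ∀ j, j ≠ i → ∀ a ∈ A j, F a = 1 := by
  obtain ⟨F, hF, hF'⟩ :=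
    (isFreeProduct_iff.1 (hA.isFreeProduct_compl i)).exists_lift_pair f 1
  exact ⟨F, hF, fun j hj a ha =>
    hF' ⟨a, (le_iSup₂_of_le (f := fun j (_ : j ≠ i) => A j) j hj le_rfl) ha⟩⟩

theorem map (hA : IsFreeFamily A) {L' : Type u} [Group L'] (e : L ≃* L') :
    IsFreeFamily fun i => (A i).map e.toMonoidHom where
  iSup_eq_top := by
    rw [← Subgroup.map_iSup, hA.iSup_eq_top]
    exact Subgroup.map_top_of_surjective _ e.surjective
  exists_lift f := by
    obtain ⟨F, hF⟩ := hA.exists_lift fun i => (f i).comp (e.toMonoidHom.subgroupMap (A i))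
    refine ⟨F.comp e.symm.toMonoidHom, ?_⟩
    rintro i ⟨_, a, ha, rfl⟩
    have := hF i ⟨a, ha⟩
    refine Eq.trans ?_ this
    exact congrArg F (e.symm_apply_apply a)

end IsFreeFamily

/-! ### Equivariant operators between `ℓ²` spaces of a group -/

/-- Real square summable functions. -/
abbrev Ell2 (α : Type*) : Type _ := lp (fun _ : α => ℝ) 2

namespace Ell2

variable {α β : Type*}

theorem norm_sq_eq_tsum (f : Ell2 α) : ‖f‖ ^ 2 = ∑' i, f i ^ 2 := by
  have h := lp.norm_rpow_eq_tsum (p := 2) (by norm_num) f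
  simpa using h

theorem summable_sq (f : Ell2 α) : Summable fun i => f i ^ 2 := by
  have h := (lp.memℓp f).summable (by norm_num)
  simpa using h

theorem memℓp_comp (φ : α → β) (hφ : Function.Injective φ) (f : Ell2 β) :
    Memℓp (fun a => (f (φ a) : ℝ)) 2 := by
  apply memℓp_gen
  simpa [Function.comp_def] using (summable_sq f).comp_injective hφ

/-- Composition with an injective map, as a bounded operator. -/
noncomputable def pull (φ : α → β) (hφ : Function.Injective φ) : Ell2 β →L[ℝ] Ell2 α :=
  LinearMap.mkContinuous
    { toFun := fun f => ⟨fun a => f (φ a), memℓp_comp φ hφ f⟩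
      map_add' := fun _ _ => rfl
      map_smul' := fun _ _ => rfl } 1 (by
    intro f
    rw [one_mul]
    apply le_of_sq_le_sq _ (norm_nonneg _)
    rw [norm_sq_eq_tsum, norm_sq_eq_tsum]
    exact tsum_comp_le_tsum_of_inj (summable_sq f) (fun i => sq_nonneg _) hφ)

@[simp]
theorem pull_apply (φ : α → β) (hφ : Function.Injective φ) (f : Ell2 β) (a : α) :
    pull φ hφ f a = f (φ a) := rfl

/-- The basis vector at `a`. -/
noncomputable def δ (a : α) : Ell2 α := by
  classical exact lp.single 2 a 1

theorem δ_apply_self (a : α) : δ a a = 1 := by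
  classical
  simp [δ]

theorem δ_apply_of_ne {a b : α} (h : b ≠ a) : δ a b = 0 := by
  classical
  simp [δ, h]

theorem inner_δ_right (f : Ell2 α) (a : α) : inner ℝ f (δ a) = f a := by
  classical
  simp [δ, lp.inner_single_right]

theorem inner_δ_left (f : Ell2 α) (a : α) : inner ℝ (δ a) f = f a := by
  rw [real_inner_comm, inner_δ_right]

theorem hasSum_inner (f g : Ell2 α) : HasSum (fun a => f a * g a) (inner ℝ f g) := by
  have h := lp.hasSum_inner (𝕜 := ℝ) f g
  simpa [mul_comm] using h

theorem pull_δ (φ : α → β) (hφ : Function.Injective φ) (a : α) : pull φ hφ (δ (φ a)) = δ a := by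
  ext b
  by_cases h : b = a
  · subst h
    simp [δ_apply_self]
  · simp [δ_apply_of_ne h, δ_apply_of_ne (fun h' => h (hφ h'))]

/-! ### Equivariant operators and the von Neumann trace -/

section Group

variable {G ι : Type*} [Group G]

/-- The right regular representation on `ℓ²(G)`. -/
noncomputable def rightTrans (x : G) : Ell2 G →L[ℝ] Ell2 G :=
  pull (fun g => g * x) (mul_left_injective x)

theorem injective_prod_mul (x : G) : Function.Injective fun p : ι × G => (p.1, p.2 * x) := by
  rintro ⟨i, g⟩ ⟨j, h⟩ hp
  simpa using hp

/-- The right regular representation on `ℓ²(ι × G)`. -/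
noncomputable def rightTransProd (x : G) : Ell2 (ι × G) →L[ℝ] Ell2 (ι × G) :=
  pull (fun p => (p.1, p.2 * x)) (injective_prod_mul x)

@[simp]
theorem rightTrans_apply (x : G) (f : Ell2 G) (g : G) : rightTrans x f g = f (g * x) := rfl

@[simp]
theorem rightTransProd_apply (x : G) (f : Ell2 (ι × G)) (p : ι × G) :
    rightTransProd x f p = f (p.1, p.2 * x) := rfl

theorem rightTrans_δ (x g : G) : rightTrans x (δ g) = δ (g * x⁻¹) := by
  have h := pull_δ (fun g => g * x) (mul_left_injective x) (g * x⁻¹)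
  simpa [rightTrans] using h

theorem rightTransProd_δ (x g : G) (i : ι) :
    rightTransProd x (δ (i, g)) = δ (i, g * x⁻¹) := by
  have h := pull_δ (fun p : ι × G => (p.1, p.2 * x)) (injective_prod_mul x) (i, g * x⁻¹)
  simpa [rightTransProd] using h

theorem inner_rightTransProd (x : G) (f f' : Ell2 (ι × G)) :
    inner ℝ (rightTransProd x f) (rightTransProd x f') = inner ℝ f f' := by
  have h := hasSum_inner f f'
  let e : ι × G ≃ ι × G := (Equiv.refl ι).prodCongr (Equiv.mulRight x)
  have h2 := (e.hasSum_iff).2 h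
  exact (hasSum_inner _ _).unique h2

theorem inner_rightTrans (x : G) (f f' : Ell2 G) :
    inner ℝ (rightTrans x f) (rightTrans x f') = inner ℝ f f' := by
  have h2 := ((Equiv.mulRight x).hasSum_iff).2 (hasSum_inner f f')
  exact (hasSum_inner _ _).unique h2

theorem rightTransProd_inv (x : G) (f : Ell2 (ι × G)) :
    rightTransProd x (rightTransProd x⁻¹ f) = f := by
  ext p
  simp

theorem rightTrans_inv (x : G) (f : Ell2 G) : rightTrans x (rightTrans x⁻¹ f) = f := by
  ext p
  simp

/-- The von Neumann trace property for equivariant operators. -/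
theorem sum_trace_comm [Fintype ι] (X : Ell2 (ι × G) →L[ℝ] Ell2 G) (Y : Ell2 G →L[ℝ] Ell2 (ι × G))
    (hX : ∀ x f, X (rightTransProd x f) = rightTrans x (X f))
    (hY : ∀ x f, Y (rightTrans x f) = rightTransProd x (Y f)) :
    ∑ i, Y (X (δ (i, 1))) (i, 1) = X (Y (δ 1)) 1 := by
  have h1 : ∀ i, HasSum (fun g => X (δ (i, 1)) g * Y (δ g) (i, 1)) (Y (X (δ (i, 1))) (i, 1)) := by
    intro i
    have h := hasSum_inner (X (δ (i, 1))) (ContinuousLinearMap.adjoint Y (δ (i, 1)))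
    rw [ContinuousLinearMap.adjoint_inner_right, inner_δ_right] at h
    convert h using 3 with g
    rw [← inner_δ_left (ContinuousLinearMap.adjoint Y (δ (i, 1))) g,
      ContinuousLinearMap.adjoint_inner_right, inner_δ_right]
  have h2 : HasSum (fun p : ι × G => Y (δ 1) p * X (δ p) 1) (X (Y (δ 1)) 1) := by
    have h := hasSum_inner (Y (δ 1)) (ContinuousLinearMap.adjoint X (δ 1))
    rw [ContinuousLinearMap.adjoint_inner_right, inner_δ_right] at h
    convert h using 3 with p
    rw [← inner_δ_left (ContinuousLinearMap.adjoint X (δ 1)) p,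
      ContinuousLinearMap.adjoint_inner_right, inner_δ_right]
  -- By equivariance, coefficients are constant along right translates; the substitution g ↦ g⁻¹
  -- then matches the two double sums.
  have h3 : ∀ (i : ι) (g : G), Y (δ 1) (i, g) = Y (δ g⁻¹) (i, 1) := by
    intro i g
    have h := congrArg (fun f : Ell2 (ι × G) => f (i, 1)) (hY g (δ 1))
    simpa [rightTrans_δ] using h.symm
  have h4 : ∀ (i : ι) (g : G), X (δ (i, g)) 1 = X (δ (i, 1)) g⁻¹ := by
    intro i g
    have h := congrArg (fun f : Ell2 G => f 1) (hX g⁻¹ (δ (i, 1)))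
    simpa [rightTransProd_δ] using h
  have h5 := h2.prod_fiberwise (g := fun i => Y (X (δ (i, 1))) (i, 1)) (by
    intro i
    have h := ((Equiv.inv G).hasSum_iff).2 (h1 i)
    convert h using 2 with g
    simp [h3, h4, mul_comm])
  exact (hasSum_fintype _).unique h5

end Group

open ContinuousLinearMap

/-! ### Resolvents of positive operators -/

section Regularization

variable {E : Type*} [NormedAddCommGroup E] [InnerProductSpace ℝ E] [CompleteSpace E]

/-- For a positive operator `S` and `ε > 0` the operator `S + ε` is invertible. -/
theorem exists_resolvent (S : E →L[ℝ] E) (hS : ∀ x, 0 ≤ inner ℝ (S x) x) {ε : ℝ} (hε : 0 < ε) :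
    ∃ R : E →L[ℝ] E, (∀ x, S (R x) + ε • R x = x) ∧ ∀ x, R (S x + ε • x) = x := by
  have hu : IsUnit (S + ε • (1 : E →L[ℝ] E)) := by
    refine isUnit_of_forall_le_norm_inner_map _ (c := ⟨ε, hε.le⟩) hε fun x => ?_
    have h1 : inner ℝ ((S + ε • (1 : E →L[ℝ] E)) x) x = inner ℝ (S x) x + ε * ‖x‖ ^ 2 := by
      simp [inner_add_left, inner_smul_left]
    rw [h1]
    refine le_trans ?_ (le_abs_self _)
    change ‖x‖ ^ 2 * ε ≤ _
    nlinarith [hS x]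
  obtain ⟨⟨a, R, h1, h2⟩, rfl : a = _⟩ := hu
  refine ⟨R, fun x => ?_, fun x => ?_⟩
  · simpa using DFunLike.congr_fun h1 x
  · simpa using DFunLike.congr_fun h2 x

-- Pair with `w` and use Cauchy–Schwarz. Applied to values of the resolvent, this bounds its norm by
-- 1/ε.
omit [CompleteSpace E] in
theorem mul_norm_le_of_add_smul {S : E →L[ℝ] E} (hS : ∀ x, 0 ≤ inner ℝ (S x) x) {ε : ℝ}
    (w : E) : ε * ‖w‖ ≤ ‖S w + ε • w‖ := by
  by_cases hw : ‖w‖ = 0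
  · rw [hw]
    simp
  · have hw' : 0 < ‖w‖ := lt_of_le_of_ne (norm_nonneg _) (Ne.symm hw)
    have h1 : inner ℝ (S w + ε • w) w ≤ ‖S w + ε • w‖ * ‖w‖ := real_inner_le_norm _ _
    rw [inner_add_left, inner_smul_left, real_inner_self_eq_norm_sq] at h1
    have h2 := hS w
    simp only [conj_trivial] at h1
    have h3 : (ε * ‖w‖) * ‖w‖ ≤ ‖S w + ε • w‖ * ‖w‖ := by nlinarith
    exact le_of_mul_le_mul_right h3 hw'

/-- The orthogonal complement of the range is the kernel of the adjoint, here zero, so the range is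
dense. -/
theorem exists_norm_sub_lt {S : E →L[ℝ] E} (hS : adjoint S = S) (hinj : ∀ x, S x = 0 → x = 0)
    (x : E) {η : ℝ} (hη : 0 < η) : ∃ y, ‖x - S y‖ < η := by
  have h1 : (S.range)ᗮ = ⊥ := by
    rw [ContinuousLinearMap.orthogonal_range, hS, eq_bot_iff]
    intro y hy
    exact hinj y hy
  have h2 := (Submodule.topologicalClosure_eq_top_iff (K := S.range)).2 h1
  have h3 : x ∈ closure (S.range : Set E) := by
    rw [← Submodule.topologicalClosure_coe, h2]
    trivial
  obtain ⟨_, ⟨y, rfl⟩, hy⟩ := Metric.mem_closure_iff.1 h3 η hη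
  exact ⟨y, by rwa [dist_eq_norm] at hy⟩

end Regularization

/-! ### Comparison of von Neumann dimensions -/

variable {G ι κ : Type*} [Group G]

theorem adjoint_equivariant {T : Ell2 (ι × G) →L[ℝ] Ell2 G}
    (hT : ∀ x f, T (rightTransProd x f) = rightTrans x (T f)) (x : G) (f : Ell2 G) :
    adjoint T (rightTrans x f) = rightTransProd x (adjoint T f) := by
  refine ext_inner_right ℝ fun h => ?_
  rw [adjoint_inner_left]
  conv_rhs => rw [← rightTransProd_inv x h]
  rw [inner_rightTransProd, adjoint_inner_left, hT,
    ← inner_rightTrans x f (rightTrans x⁻¹ (T h)), rightTrans_inv]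

/-- A jointly injective family of `m` bounded right-equivariant operators `ℓ²(G)ⁿ → ℓ²(G)` exists
only if `n ≤ m`. -/
theorem card_le_of_equivariant [Fintype ι] [Fintype κ] (T : κ → Ell2 (ι × G) →L[ℝ] Ell2 G)
    (hT : ∀ j x f, T j (rightTransProd x f) = rightTrans x (T j f))
    (hinj : ∀ f, (∀ j, T j f = 0) → f = 0) : Fintype.card ι ≤ Fintype.card κ := by
  -- S is positive, equivariant, and injective because the family is. With R = (S + ε)⁻¹, the trace
  -- of RS is at most |κ| by commutation under the trace, while RS tends strongly to 1, so its trace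
  -- tends to |ι|. Explicit bounds replace the limit.
  let S : Ell2 (ι × G) →L[ℝ] Ell2 (ι × G) := ∑ j, adjoint (T j) ∘L T j
  have hSapply : ∀ f, S f = ∑ j, adjoint (T j) (T j f) := fun f => by
    simp [S]
  have hinner : ∀ f, inner ℝ (S f) f = ∑ j, ‖T j f‖ ^ 2 := by
    intro f
    rw [hSapply, sum_inner]
    refine Finset.sum_congr rfl fun j _ => ?_
    rw [adjoint_inner_left, real_inner_self_eq_norm_sq]
  have hpos : ∀ f, 0 ≤ inner ℝ (S f) f := fun f => by
    rw [hinner]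
    positivity
  have hSadj : adjoint S = S := by
    simp only [S, map_sum, adjoint_comp, adjoint_adjoint]
  have hSinj : ∀ f, S f = 0 → f = 0 := by
    intro f hf
    apply hinj
    have h1 := hinner f
    rw [hf, inner_zero_left] at h1
    intro j
    have h2 := (Finset.sum_eq_zero_iff_of_nonneg (fun j _ => by positivity)).1 h1.symm j
      (Finset.mem_univ j)
    simpa using h2
  have hSeq : ∀ x f, S (rightTransProd x f) = rightTransProd x (S f) := by
    intro x f
    simp only [hSapply, map_sum, hT, adjoint_equivariant (hT _)]
  by_contra! hlt
  have hlt' : (Fintype.card κ : ℝ) + 1 ≤ Fintype.card ι := by exact_mod_cast hlt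
  set n : ℝ := ((Fintype.card ι : ℕ) : ℝ) with hn
  have hn0 : 0 < n := by
    have : (0 : ℝ) ≤ Fintype.card κ := by positivity
    linarith
  choose y hy using fun i : ι => exists_norm_sub_lt hSadj hSinj (δ (i, 1))
    (show (0 : ℝ) < 1 / (2 * n) by positivity)
  set M : ℝ := ∑ i, ‖y i‖ with hM
  have hM0 : 0 ≤ M := Finset.sum_nonneg fun i _ => norm_nonneg _
  -- Chosen so that 2εM < 1/2. Together with the errors 1/(2n), which add up to 1/2, the trace of RS
  -- is more than n − 1.
  let ε : ℝ := 1 / (4 * (M + 1))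
  have hε : 0 < ε := by positivity
  obtain ⟨R, hR1, hR2⟩ := exists_resolvent S hpos hε
  have hReq : ∀ x f, R (rightTransProd x f) = rightTransProd x (R f) := by
    intro x f
    have h1 : rightTransProd x f
        = S (rightTransProd x (R f)) + ε • rightTransProd x (R f) := by
      rw [hSeq, ← map_smul, ← map_add, hR1]
    rw [h1, hR2]
  have hRnorm : ∀ f, ε * ‖R f‖ ≤ ‖f‖ := fun f => by
    have := mul_norm_le_of_add_smul hpos (ε := ε) (R f)
    rwa [hR1] at this
  have htrace : ∑ i, R (S (δ (i, 1))) (i, 1) ≤ Fintype.card κ := by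
    have h1 : ∑ i, R (S (δ (i, 1))) (i, 1)
        = ∑ j, T j (R (adjoint (T j) (δ 1))) 1 := by
      have h2 : ∀ i, R (S (δ (i, 1))) (i, 1)
          = ∑ j, (R ∘L adjoint (T j)) (T j (δ (i, 1))) (i, 1) := by
        intro i
        rw [hSapply, map_sum, lp.coeFn_sum, Finset.sum_apply]
        rfl
      simp only [h2]
      rw [Finset.sum_comm]
      refine Finset.sum_congr rfl fun j _ => ?_
      exact sum_trace_comm (T j) (R ∘L adjoint (T j)) (hT j) fun x f => by
        simp only [coe_comp, Function.comp_apply, adjoint_equivariant (hT j), hReq]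
    rw [h1, Fintype.card_eq_sum_ones]
    push_cast
    refine Finset.sum_le_sum fun j _ => ?_
    set z := R (adjoint (T j) (δ 1)) with hz
    -- Since (S + ε)z = T_j^* δ, the right side equals (T_j z)(1), which is at most ‖T_j z‖; so ‖T_j
    -- z‖ ≤ 1 and (T_j z)(1) ≤ 1.
    have h3 : ‖T j z‖ ^ 2 ≤ inner ℝ (S z + ε • z) z := by
      rw [inner_add_left, hinner, inner_smul_left, real_inner_self_eq_norm_sq]
      have h4 : ‖T j z‖ ^ 2 ≤ ∑ j, ‖T j z‖ ^ 2 :=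
        Finset.single_le_sum (f := fun j => ‖T j z‖ ^ 2) (fun j _ => by positivity)
          (Finset.mem_univ j)
      have h5 : 0 ≤ ε * ‖z‖ ^ 2 := by positivity
      simpa using h4.trans (le_add_of_nonneg_right h5)
    rw [hz, hR1, ← hz, adjoint_inner_left, inner_δ_left] at h3
    have h6 : |T j z 1| ≤ ‖T j z‖ := lp.norm_apply_le_norm (by norm_num) (T j z) 1
    have h7 := (abs_le.1 h6).2
    nlinarith [norm_nonneg (T j z)]
  have hbound : ∀ i, 1 - R (S (δ (i, 1))) (i, 1) ≤ 1 / (2 * n) + 2 * ε * ‖y i‖ := by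
    intro i
    have h1 : (1 : ℝ) - R (S (δ (i, 1))) (i, 1) = ε * R (δ (i, 1)) (i, 1) := by
      have h2 := congrArg (fun f : Ell2 (ι × G) => f (i, 1)) (hR2 (δ (i, 1)))
      simp only [map_add, map_smul, δ_apply_self] at h2
      have h3 : R (S (δ (i, 1))) (i, 1) + ε * R (δ (i, 1)) (i, 1) = 1 := h2
      linarith
    rw [h1]
    have h2 : R (δ (i, 1)) (i, 1) ≤ ‖R (δ (i, 1))‖ :=
      (le_abs_self _).trans (lp.norm_apply_le_norm (by norm_num) (R (δ (i, 1))) (i, 1))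
    -- The norm of R is only bounded by 1/ε, so it is applied to the small vector δ − Sy, while RSy
    -- = y − εRy stays bounded in terms of y alone.
    have h3 : R (δ (i, 1)) = R (δ (i, 1) - S (y i)) + (y i - ε • R (y i)) := by
      have h4 := hR2 (y i)
      rw [map_add, map_smul] at h4
      nth_rw 2 [← h4]
      rw [map_sub]
      abel
    have h4 : ε * ‖R (δ (i, 1))‖ ≤ ε * ‖R (δ (i, 1) - S (y i))‖ + ε * ‖y i‖
        + ε * ‖ε • R (y i)‖ := by
      rw [← mul_add, ← mul_add]
      refine mul_le_mul_of_nonneg_left ?_ hε.le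
      rw [h3, add_assoc]
      refine (norm_add_le _ _).trans (add_le_add_right (norm_sub_le _ _) _)
    have h5 : ε * ‖R (δ (i, 1) - S (y i))‖ ≤ 1 / (2 * n) := (hRnorm _).trans (hy i).le
    have h6 : ‖ε • R (y i)‖ ≤ ‖y i‖ := by
      rw [norm_smul, Real.norm_of_nonneg hε.le]
      exact hRnorm _
    nlinarith
  have hsum : n - ∑ i, R (S (δ (i, 1))) (i, 1) ≤ 1 / 2 + 2 * ε * M := by
    have h1 := Finset.sum_le_sum fun i (_ : i ∈ Finset.univ) => hbound i
    rw [Finset.sum_sub_distrib, Finset.sum_add_distrib, ← Finset.mul_sum] at h1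
    simp only [Finset.sum_const, Finset.card_univ, nsmul_eq_mul] at h1
    rw [← hn, mul_one] at h1
    have h2 : n * (1 / (2 * n)) = 1 / 2 := by field_simp
    rwa [h2] at h1
  have hlast : 2 * ε * M < 1 / 2 := by
    have : 2 * ε * M = M / (2 * (M + 1)) := by
      simp only [ε]
      field_simp
      norm_num
    rw [this, div_lt_div_iff₀ (by positivity) (by norm_num)]
    nlinarith
  linarith

/-! ### Derivations of a free product -/

variable {L : Type u} [Group L] {ι : Type}

/-- The left regular representation on `ℓ²(L)`. -/
noncomputable def leftTrans (x : L) : Ell2 L →L[ℝ] Ell2 L :=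
  pull (fun g => x⁻¹ * g) (mul_right_injective x⁻¹)

@[simp]
theorem leftTrans_apply (x : L) (f : Ell2 L) (g : L) : leftTrans x f g = f (x⁻¹ * g) := rfl

theorem leftTrans_mul (x y : L) : leftTrans (x * y) = leftTrans x ∘L leftTrans y := by
  ext f g
  simp [mul_assoc]

theorem leftTrans_one : leftTrans (1 : L) = ContinuousLinearMap.id ℝ _ := by
  ext f g
  simp

theorem leftTrans_rightTrans (x y : L) (f : Ell2 L) :
    leftTrans x (rightTrans y f) = rightTrans y (leftTrans x f) := by
  ext g
  simp [mul_assoc]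

/-- The `i`-th coordinate `ℓ²(ι × L) → ℓ²(L)`. -/
noncomputable def coord (i : ι) : Ell2 (ι × L) →L[ℝ] Ell2 L :=
  pull (fun g => (i, g)) fun _ _ h => (Prod.ext_iff.1 h).2

omit [Group L] in
@[simp]
theorem coord_apply (i : ι) (f : Ell2 (ι × L)) (g : L) : coord i f g = f (i, g) := rfl

theorem coord_rightTransProd (i : ι) (x : L) (f : Ell2 (ι × L)) :
    coord i (rightTransProd x f) = rightTrans x (coord i f) := by
  ext g
  simp

/-- The action of a group by left translations on operators, conjugated by a translation. -/
noncomputable def affineAction (i : ι) (A : Subgroup L) :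
    A →* Equiv.Perm (Ell2 (ι × L) →L[ℝ] Ell2 L) :=
  MonoidHom.toHomPerm
    { toFun := fun a X => leftTrans (a : L) ∘L (X + coord i) - coord i
      map_one' := by
        funext X
        change leftTrans (1 : L) ∘L (X + coord i) - coord i = X
        simp [leftTrans_one]
      map_mul' := fun a b => by
        funext X
        change leftTrans ((a : L) * b) ∘L (X + coord i) - coord i = leftTrans (a : L) ∘L
          (leftTrans (b : L) ∘L (X + coord i) - coord i + coord i) - coord i
        rw [sub_add_cancel, leftTrans_mul, ContinuousLinearMap.comp_assoc] }

theorem affineAction_apply (i : ι) (A : Subgroup L) (a : A)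
    (X : Ell2 (ι × L) →L[ℝ] Ell2 L) :
    affineAction i A a X = leftTrans (a : L) ∘L (X + coord i) - coord i := rfl

/-- An `ℓ²` function invariant under left translations by an infinite subgroup vanishes. -/
theorem eq_zero_of_invariant (A : Subgroup L) [Infinite A] (f : Ell2 L)
    (hf : ∀ a ∈ A, leftTrans a f = f) : f = 0 := by
  ext g
  have h1 := (summable_sq f).comp_injective
    (i := fun a : A => (a : L)⁻¹ * g) fun a b h => by simpa using h
  have h2 : (fun i => f i ^ 2) ∘ (fun a : A => (a : L)⁻¹ * g) = fun _ => f g ^ 2 := by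
    funext a
    have := congrArg (fun f : Ell2 L => f g) (hf a a.2)
    simp only [leftTrans_apply] at this
    simp [this]
  rw [h2, summable_const_iff] at h1
  simpa using h1

/-- If `L` is a free product of `n` infinite subgroups, there is a derivation of `L` with values in
the bounded equivariant operators `ℓ²(L)ⁿ → ℓ²(L)` which is inner on each factor, with respect to
the corresponding coordinate. -/
theorem exists_derivation {A : ι → Subgroup L} (hA : IsFreeFamily A) :
    ∃ D : L → Ell2 (ι × L) →L[ℝ] Ell2 L,
      (∀ x y, D (x * y) = leftTrans x ∘L D y + D x) ∧
      (∀ i, ∀ a ∈ A i, D a = leftTrans a ∘L coord i - coord i) ∧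
      ∀ x g f, D x (rightTransProd g f) = rightTrans g (D x f) := by
  -- A derivation is the displacement of 0 under an affine action. Homomorphisms to a permutation
  -- group glue over the factors, and conjugating by the translation by `coord i` makes `a` move 0
  -- by (a − 1) ∘ `coord i`.
  obtain ⟨F, hF⟩ := hA.exists_lift (fun i => affineAction i (A i))
  have h1 : ∀ x X, F x X = leftTrans x ∘L X + F x 0 := by
    let H : Subgroup L :=
      { carrier := {x | ∀ X, F x X = leftTrans x ∘L X + F x 0}
        one_mem' := fun X => by simp [leftTrans_one]
        mul_mem' := fun {x y} hx hy X => by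
          rw [map_mul, Equiv.Perm.mul_apply, Equiv.Perm.mul_apply, hx, hy, hx (F y 0),
            leftTrans_mul, ContinuousLinearMap.comp_add, ContinuousLinearMap.comp_assoc, add_assoc]
        inv_mem' := fun {x} hx X => by
          have h : leftTrans x ∘L leftTrans x⁻¹ = ContinuousLinearMap.id ℝ (Ell2 L) := by
            rw [← leftTrans_mul, mul_inv_cancel, leftTrans_one]
          apply (F x).injective
          rw [hx (leftTrans x⁻¹ ∘L X + F x⁻¹ 0), ContinuousLinearMap.comp_add, add_assoc,
            ← hx (F x⁻¹ 0), ← Equiv.Perm.mul_apply, ← Equiv.Perm.mul_apply, ← map_mul,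
            mul_inv_cancel, ← ContinuousLinearMap.comp_assoc, h]
          simp }
    refine fun x => hA.mem_of_forall_le (H := H) (fun i a ha X => ?_) x
    rw [hF i ⟨a, ha⟩, affineAction_apply, affineAction_apply, ContinuousLinearMap.comp_add, zero_add]
    abel
  have h2 : ∀ x y, F (x * y) 0 = leftTrans x ∘L F y 0 + F x 0 := fun x y => by
    rw [map_mul, Equiv.Perm.mul_apply, h1 x]
  refine ⟨fun x => F x 0, h2, fun i a ha => ?_, ?_⟩
  · have := hF i ⟨a, ha⟩
    change F a 0 = _
    rw [this, affineAction_apply, zero_add]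
  · let H : Subgroup L :=
      { carrier := {x | ∀ g f, F x 0 (rightTransProd g f) = rightTrans g (F x 0 f)}
        one_mem' := fun g f => by simp
        mul_mem' := fun {x y} hx hy g f => by
          simp only [h2, _root_.add_apply, ContinuousLinearMap.comp_apply, map_add]
          rw [hx, hy, leftTrans_rightTrans]
        inv_mem' := fun {x} hx g f => by
          have h3 := h2 x⁻¹ x
          simp only [inv_mul_cancel, map_one, Equiv.Perm.one_apply] at h3
          have h4 : F x⁻¹ 0 = -(leftTrans x⁻¹ ∘L F x 0) := eq_neg_of_add_eq_zero_right h3.symm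
          rw [h4]
          simp only [_root_.neg_apply, ContinuousLinearMap.comp_apply, map_neg]
          rw [hx, leftTrans_rightTrans] }
    refine fun x => hA.mem_of_forall_le (H := H) (fun i a ha g f => ?_) x
    rw [hF i ⟨a, ha⟩, affineAction_apply, zero_add]
    simp only [_root_.sub_apply, ContinuousLinearMap.comp_apply, map_sub,
      coord_rightTransProd, leftTrans_rightTrans]

end Ell2

open Ell2 in
/-- A group generated by `m` elements is not the free product of more than `m` infinite
subgroups. -/
theorem IsFreeFamily.card_le {L : Type u} [Group L] {ι : Type} [Fintype ι] {A : ι → Subgroup L}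
    (hA : IsFreeFamily A) (hinf : ∀ i, Infinite (A i)) (s : Finset L)
    (hs : Subgroup.closure (s : Set L) = ⊤) : Fintype.card ι ≤ s.card := by
  obtain ⟨D, hmul, hD, heq⟩ := exists_derivation hA
  rw [← Fintype.card_coe s]
  refine card_le_of_equivariant (fun x : s => D x) (fun x g f => heq x g f) fun f hf => ?_
  -- By the derivation rule, the elements `x` with D_x f = 0 form a subgroup; if it contains the
  -- generators it is all of `L`. On `A i` this says that the i-th coordinate of `f` is invariant,
  -- hence zero.
  let H : Subgroup L :=
    { carrier := {x | D x f = 0}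
      one_mem' := by
        have h := hmul 1 1
        rw [mul_one, leftTrans_one] at h
        simp at h
        simp [h]
      mul_mem' := fun {x y} (hx : D x f = 0) (hy : D y f = 0) => by
        simp [hmul, hx, hy]
      inv_mem' := fun {x} (hx : D x f = 0) => by
        have h1 := hmul x x⁻¹
        have h2 := hmul x⁻¹ x
        have h := hmul 1 1
        rw [mul_one, leftTrans_one] at h
        simp at h
        rw [inv_mul_cancel, h] at h2
        have h3 := DFunLike.congr_fun h2 f
        simp [hx] at h3
        exact h3.symm }
  have h1 : ∀ x, D x f = 0 := fun x => by
    have h2 : Subgroup.closure (s : Set L) ≤ H := (Subgroup.closure_le _).2 fun x hx => hf ⟨x, hx⟩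
    rw [hs] at h2
    exact h2 trivial
  ext ⟨i, g⟩
  have h2 : coord i f = 0 := by
    have := hinf i
    refine eq_zero_of_invariant (A i) _ fun a ha => ?_
    have h3 := h1 a
    rw [hD i a ha] at h3
    exact sub_eq_zero.1 h3
  exact congrArg (fun f : Ell2 L => f g) h2

/-! ### Existence of relative Grushko decompositions -/

namespace IsFreeFamily

variable {L : Type u} [Group L] {ι : Type*} {A : ι → Subgroup L}

/-- Replace a factor of a free product by the two factors of a decomposition of it. -/
theorem refine_factor (hA : IsFreeFamily A) (i : ι) {X Y : Subgroup (A i)}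
    (h : IsFreeProduct X Y) {B : Option ι → Subgroup L} (hY : B none = Y.map (A i).subtype)
    (hX : B (some i) = X.map (A i).subtype) (hB : ∀ j, j ≠ i → B (some j) = A j) :
    IsFreeFamily B where
  iSup_eq_top := by
    rw [eq_top_iff, ← hA.iSup_eq_top]
    refine iSup_le fun j => ?_
    by_cases hj : j = i
    · subst hj
      have h1 := (isFreeProduct_iff.1 h).iSup_eq_top
      rw [iSup_bool_eq] at h1
      have h2 : A j = (X ⊔ Y).map (A j).subtype := by
        change X ⊔ Y = ⊤ at h1
        rw [h1, ← MonoidHom.range_eq_map, Subgroup.range_subtype]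
      rw [h2, Subgroup.map_sup, ← hX, ← hY]
      exact sup_le (le_iSup B (some j)) (le_iSup B none)
    · rw [← hB j hj]
      exact le_iSup B (some j)
  exists_lift {Z} _ f := by
    classical
    let fX : X →* Z := (f (some i)).comp
      (((A i).subtype.comp X.subtype).codRestrict (B (some i)) fun x => by
        rw [hX]
        exact ⟨x, x.2, rfl⟩)
    let fY : Y →* Z := (f none).comp
      (((A i).subtype.comp Y.subtype).codRestrict (B none) fun x => by
        rw [hY]
        exact ⟨x, x.2, rfl⟩)
    obtain ⟨g, hg1, hg2⟩ := (isFreeProduct_iff.1 h).exists_lift_pair fX fY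
    obtain ⟨F, hF⟩ := hA.exists_lift fun j =>
      if hj : j = i then g.comp (Subgroup.inclusion (hj ▸ le_rfl))
      else (f (some j)).comp (Subgroup.inclusion (hB j hj).ge)
    have hFi : ∀ a : A i, F a = g a := fun a => by
      rw [hF i a, dif_pos rfl]
      rfl
    refine ⟨F, ?_⟩
    rintro (_ | j) ⟨b, hb⟩
    · have hb' := hb
      rw [hY] at hb'
      obtain ⟨y, hy, rfl⟩ := hb'
      exact (hFi y).trans (hg2 ⟨y, hy⟩)
    · by_cases hj : j = i
      · subst hj
        have hb' := hb
        rw [hX] at hb'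
        obtain ⟨y, hy, rfl⟩ := hb'
        exact (hFi y).trans (hg1 ⟨y, hy⟩)
      · have hb' := hb
        rw [hB j hj] at hb'
        refine (hF j ⟨b, hb'⟩).trans ?_
        rw [dif_neg hj]
        rfl

end IsFreeFamily

theorem infinite_of_torsionFree {L : Type*} [Group L] (htf : IsTorsionFreeGroup L)
    {A : Subgroup L} (hA : A ≠ ⊥) : Infinite A := by
  obtain ⟨a, h1⟩ := A.ne_bot_iff_exists_ne_one.1 hA
  by_contra hfin
  rw [not_infinite_iff_finite] at hfin
  refine htf a (fun h => h1 (Subtype.ext h)) ?_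
  exact Submonoid.isOfFinOrder_coe.2 (isOfFinOrder_of_finite a)

/-- An arrangement of the factors of a free product, those which are infinite cyclic being gathered
in a free group, as in a Grushko decomposition. -/
theorem IsFreeFamily.exists_isGrushkoDecomposition {L : Type u} [Group L] {ι : Type} [Finite ι]
    {A : ι → Subgroup L} (hA : IsFreeFamily A) (i₀ : ι) {H : Subgroup L} (hH : H ≤ A i₀)
    (h0 : FreelyIndecomposableRel (H.subgroupOf (A i₀))) (hne : ∀ i, A i ≠ ⊥)
    (hind : ∀ i, i ≠ i₀ → FreelyIndecomposable (A i)) :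
    ∃ (n r : ℕ) (L₀ : Subgroup L) (G : Fin n → Subgroup L) (t : Fin r → L),
      IsGrushkoDecomposition H L₀ G t := by
  classical
  let J := {i : ι // i ≠ i₀ ∧ ¬ Nonempty (A i ≃* Multiplicative ℤ)}
  let K := {i : ι // i ≠ i₀ ∧ Nonempty (A i ≃* Multiplicative ℤ)}
  let eJ : Fin (Nat.card J) ≃ J := (Finite.equivFin J).symm
  let eK : Fin (Nat.card K) ≃ K := (Finite.equivFin K).symm
  let z : ∀ k : K, A k ≃* Multiplicative ℤ := fun k => k.2.2.some
  let G : Fin (Nat.card J) → Subgroup L := fun a => A (eJ a)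
  let t : Fin (Nat.card K) → L := fun a => ((z (eK a)).symm (Multiplicative.ofAdd 1) : A (eK a))
  refine ⟨Nat.card J, Nat.card K, A i₀, G, t, ⟨⟨?_, ?_⟩, hH, h0, fun a => ?_, fun a => ?_,
    fun a => hind _ (eJ a).2.1⟩⟩
  · let f : ∀ i, A i →*
        Coprod (Coprod (A i₀) (CoprodI fun a => G a)) (FreeGroup (Fin (Nat.card K))) := fun i =>
      if h : i = i₀ then
        (Coprod.inl.comp Coprod.inl).comp (Subgroup.inclusion (h ▸ le_rfl))
      else if h' : Nonempty (A i ≃* Multiplicative ℤ) then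
        (Coprod.inr.comp (zpowersHom _ (FreeGroup.of (eK.symm ⟨i, h, h'⟩)))).comp
          (z ⟨i, h, h'⟩).toMonoidHom
      else (Coprod.inl.comp (Coprod.inr.comp (CoprodI.of (i := eJ.symm ⟨i, h, h'⟩)))).comp
        (Subgroup.inclusion (by simp [G]))
    obtain ⟨F, hF⟩ := hA.exists_lift
      (X := Coprod (Coprod (A i₀) (CoprodI fun a => G a)) (FreeGroup (Fin (Nat.card K)))) f
    have h1 : F.comp (Coprod.lift (Coprod.lift (A i₀).subtype
        (CoprodI.lift fun i => (G i).subtype)) (FreeGroup.lift t)) = MonoidHom.id _ := by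
      refine Coprod.hom_ext (Coprod.hom_ext ?_ ?_) ?_
      · ext a
        refine (hF i₀ a).trans ?_
        simp only [f, dif_pos rfl]
        rfl
      · refine CoprodI.ext_hom _ _ fun a => ?_
        ext g
        have h2 : F g = f (eJ a) g := hF _ g
        -- `eJ.symm (eJ a)` is `a` only propositionally, so elements of the dependent factors are
        -- compared through their values in `L`.
        have h3 : ∀ b : J, b = eJ a → ∀ (x : A b) (y : G a), (x : L) = y →
            f b x = Coprod.inl (Coprod.inr (CoprodI.of (M := fun a => ↥(G a)) y)) := by
          rintro b hb x y hxy
          simp only [f, dif_neg b.2.1, dif_neg b.2.2, MonoidHom.comp_apply]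
          congr 2
          have h4 : eJ.symm b = a := by rw [hb, Equiv.symm_apply_apply]
          have h5 : ∀ (c : Fin (Nat.card J)) (hc : c = a) (w : G c), (w : L) = y →
              (CoprodI.of (M := fun a => ↥(G a)) w) = CoprodI.of (i := a) y := by
            rintro c rfl w hw
            rw [Subtype.ext hw]
          exact h5 _ h4 _ hxy
        simp only [MonoidHom.comp_apply, Coprod.lift_apply_inl, Coprod.lift_apply_inr,
          CoprodI.lift_of, MonoidHom.id_apply]
        exact h2.trans (h3 (eJ a) rfl g g rfl)
      · ext a
        simp only [MonoidHom.comp_apply, Coprod.lift_apply_inr, FreeGroup.lift_apply_of,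
          MonoidHom.id_apply]
        refine (hF (eK a) _).trans ?_
        simp only [f, dif_neg (eK a).2.1, dif_pos (eK a).2.2]
        change Coprod.inr (zpowersHom _ (FreeGroup.of (eK.symm (eK a)))
          (z (eK a) ((z (eK a)).symm (Multiplicative.ofAdd 1)))) = _
        rw [MulEquiv.apply_symm_apply, Equiv.symm_apply_apply]
        simp
    exact Function.LeftInverse.injective (g := F) fun x => DFunLike.congr_fun h1 x
  · let φ : Coprod (Coprod (A i₀) (CoprodI fun a => G a)) (FreeGroup (Fin (Nat.card K))) →* L :=
      Coprod.lift (Coprod.lift (A i₀).subtype (CoprodI.lift fun i => (G i).subtype))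
        (FreeGroup.lift t)
    intro x
    change x ∈ MonoidHom.mrange φ
    have hx : x ∈ ⨆ i, A i := by
      rw [hA.iSup_eq_top]
      trivial
    refine Subgroup.iSup_induction A (C := fun x => x ∈ MonoidHom.mrange φ) hx
      (fun i a ha => ?_) (one_mem _) fun _ _ => mul_mem
    by_cases h : i = i₀
    · subst h
      exact ⟨Coprod.inl (Coprod.inl ⟨a, ha⟩), by simp [φ]⟩
    by_cases h' : Nonempty (A i ≃* Multiplicative ℤ)
    · let k : K := ⟨i, h, h'⟩
      let m : ℤ := (z k ⟨a, ha⟩).toAdd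
      refine ⟨Coprod.inr (FreeGroup.of (eK.symm k) ^ m), ?_⟩
      have h3 : ∀ b, eK b = k → t b ^ m = a := by
        intro b hb
        have h4 : ∀ k' : K, k' = k →
            (((z k').symm (Multiplicative.ofAdd 1) : A k') : L) ^ m = a := by
          rintro _ rfl
          rw [← Subgroup.coe_zpow, ← map_zpow, ← ofAdd_zsmul]
          simp [m]
        exact h4 _ hb
      simpa [φ] using h3 _ (eK.apply_symm_apply k)
    · let k : J := ⟨i, h, h'⟩
      have h3 : a ∈ G (eJ.symm k) := by simpa [G, k] using ha
      refine ⟨Coprod.inl (Coprod.inr (CoprodI.of (i := eJ.symm k) ⟨a, h3⟩)), ?_⟩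
      simp [φ]
  · exact (Subgroup.nontrivial_iff_ne_bot _).2 (hne _)
  · exact (eJ a).2.2

/-- A finitely generated torsion-free group has a Grushko decomposition relative to any nontrivial
subgroup. -/
theorem exists_isGrushkoDecomposition {L : Type u} [Group L] (htf : IsTorsionFreeGroup L)
    [hfg : Group.FG L] {H : Subgroup L} (hH : H ≠ ⊥) :
    ∃ (n r : ℕ) (L₀ : Subgroup L) (G : Fin n → Subgroup L) (t : Fin r → L),
      IsGrushkoDecomposition H L₀ G t := by
  classical
  obtain ⟨_, s, -, hs⟩ := Group.fg_iff'.1 hfg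
  -- Numbers of factors in free decompositions with nontrivial factors, one of them containing `H`.
  -- Splitting a factor of a maximal decomposition, compatibly with `H` for the base, would exceed
  -- the maximum.
  let S : Set ℕ := {k | ∃ (ι : Type) (_ : Finite ι) (i₀ : ι) (A : ι → Subgroup L),
    Nat.card ι = k ∧ IsFreeFamily A ∧ H ≤ A i₀ ∧ ∀ i, A i ≠ ⊥}
  have hbdd : BddAbove S := by
    refine ⟨s.card, ?_⟩
    rintro k ⟨ι, _, i₀, A, rfl, hA, -, hne⟩
    have := Fintype.ofFinite ι
    rw [Nat.card_eq_fintype_card]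
    exact hA.card_le (fun i => infinite_of_torsionFree htf (hne i)) s hs
  have hS : S.Nonempty := by
    refine ⟨1, Unit, inferInstance, (), fun _ => ⊤, by simp, ⟨by simp, fun f => ?_⟩, le_top,
      fun _ h => hH (eq_bot_iff.2 (h ▸ le_top))⟩
    exact ⟨(f ()).comp Subgroup.topEquiv.symm.toMonoidHom, fun i a => rfl⟩
  obtain ⟨ι, hfin, i₀, A, hk, hA, hHA, hne⟩ := Nat.sSup_mem hS hbdd
  have hmax : ∀ i (X Y : Subgroup (A i)), IsFreeProduct X Y →
      (i = i₀ → H.subgroupOf (A i) ≤ X) → X = ⊥ ∨ Y = ⊥ := by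
    intro i X Y hXY hHX
    by_contra! hcon
    obtain ⟨hX, hY⟩ := hcon
    let B : Option ι → Subgroup L := fun o => o.elim (Y.map (A i).subtype)
      (Function.update A i (X.map (A i).subtype))
    have hBi : B (some i) = X.map (A i).subtype := by simp [B]
    have hBj : ∀ j, j ≠ i → B (some j) = A j := fun j hj => by simp [B, hj]
    have hmem : Nat.card (Option ι) ∈ S := by
      refine ⟨Option ι, inferInstance, some i₀, B, rfl, hA.refine_factor i hXY rfl hBi hBj, ?_, ?_⟩
      · by_cases hi : i₀ = i
        · subst hi
          rw [hBi]
          intro h hh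
          exact ⟨⟨h, hHA hh⟩, hHX rfl hh, rfl⟩
        · rw [hBj _ hi]
          exact hHA
      · rintro (_ | j)
        · exact fun h => hY ((Subgroup.map_eq_bot_iff_of_injective _
            (A i).subtype_injective).1 h)
        · by_cases hj : j = i
          · subst hj
            rw [hBi]
            exact fun h => hX ((Subgroup.map_eq_bot_iff_of_injective _
              (A j).subtype_injective).1 h)
          · rw [hBj j hj]
            exact hne j
    have h1 := le_csSup hbdd hmem
    rw [← hk, Finite.card_option] at h1
    omega
  exact hA.exists_isGrushkoDecomposition i₀ hHA (fun X Y hXY h => hmax i₀ X Y hXY fun _ => h) hne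
    fun i hi X Y hXY => hmax i X Y hXY fun h => absurd h hi

/-! ### Cocycles and subgroups of free products -/

namespace IsFreeFamily

variable {L : Type u} [Group L] {ι : Type*} {A : ι → Subgroup L}

/-- Cocycles of the factors of a free product acting on a set extend to a cocycle of the free
product. -/
theorem exists_cocycle (hA : IsFreeFamily A) {S P : Type u} [MulAction L S] [Group P]
    (d : ι → L → S → P)
    (hd : ∀ i, ∀ a ∈ A i, ∀ b ∈ A i, ∀ s, d i (a * b) s = d i a (b • s) * d i b s) :
    ∃ D : L → S → P, (∀ x y s, D (x * y) s = D x (y • s) * D y s) ∧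
      ∀ i, ∀ a ∈ A i, ∀ s, D a s = d i a s := by
  -- A cocycle is a section of the projection (S → P) ⋊ L → L, that is, a homomorphism, and these
  -- extend over a free product. The shift by `a⁻¹` passes from values indexed by the source of an
  -- arrow `s → a • s` to values indexed by its target.
  let f : ∀ i, A i →* (S → P) ⋊[mulAutArrow] L := fun i => MonoidHom.mk'
    (fun a => ⟨fun s => d i a ((a : L)⁻¹ • s), a⟩) fun a b => by
      refine SemidirectProduct.ext ?_ rfl
      funext s
      simp only [SemidirectProduct.mul_left, Pi.mul_apply]
      change d i (a * b : L) (((a * b : L))⁻¹ • s)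
        = d i a ((a : L)⁻¹ • s) * d i b ((b : L)⁻¹ • (a : L)⁻¹ • s)
      rw [hd i a a.2 b b.2, mul_inv_rev, mul_smul, smul_inv_smul]
  obtain ⟨F, hF⟩ := hA.exists_lift f
  have hright : SemidirectProduct.rightHom.comp F = MonoidHom.id L := by
    refine hA.hom_ext fun i a ha => ?_
    rw [MonoidHom.comp_apply, hF i ⟨a, ha⟩]
    rfl
  have hright' : ∀ x, (F x).right = x := fun x => DFunLike.congr_fun hright x
  refine ⟨fun x s => (F x).left (x • s), fun x y s => ?_, fun i a ha s => ?_⟩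
  · simp only [map_mul, SemidirectProduct.mul_left, Pi.mul_apply, hright' x]
    change (F x).left ((x * y) • s) * (F y).left (x⁻¹ • (x * y) • s) = _
    rw [mul_smul, inv_smul_smul]
  · simp only [hF i ⟨a, ha⟩]
    change d i a (a⁻¹ • a • s) = _
    rw [inv_smul_smul]

end IsFreeFamily

/-! ### Subgroups meeting the conjugates of the factors trivially -/

section Cosets

variable {L : Type u} [Group L] (H : Subgroup L)

/-- Choice of a point in each orbit, subject to a condition. -/
theorem exists_orbit_choice {S : Type*} [MulAction L S] (A : Subgroup L) (Q : S → S → Prop)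
    (h : ∀ s, ∃ a ∈ A, Q s (a • s)) (hQ : ∀ s t, ∀ a ∈ A, Q s t → Q (a • s) t) :
    ∃ o : S → S, (∀ s, ∃ a ∈ A, a • o s = s) ∧ (∀ s, ∀ a ∈ A, o (a • s) = o s) ∧
      ∀ s, Q s (o s) := by
  choose g hgA hg using h
  let R := MulAction.orbitRel A S
  let rep : S → S := fun s => @Quotient.out S R (@Quotient.mk S R s)
  have hrep : ∀ s, ∃ a ∈ A, a • rep s = s := by
    intro s
    have h1 : R s (rep s) := R.symm (@Quotient.mk_out S R s)
    obtain ⟨a, ha⟩ := MulAction.orbitRel_apply.1 h1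
    exact ⟨a, a.2, ha⟩
  have hinv : ∀ s, ∀ a ∈ A, rep (a • s) = rep s := by
    intro s a ha
    have : @Quotient.mk S R (a • s) = @Quotient.mk S R s :=
      @Quotient.sound S R _ _ (MulAction.orbitRel_apply.2 ⟨⟨a, ha⟩, rfl⟩)
    simp only [rep, this]
  refine ⟨fun s => g (rep s) • rep s, fun s => ?_, fun s a ha => ?_, fun s => ?_⟩
  · obtain ⟨a, ha, h1⟩ := hrep s
    refine ⟨a * (g (rep s))⁻¹, A.mul_mem ha (A.inv_mem (hgA _)), ?_⟩
    rw [mul_smul, inv_smul_smul, h1]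
  · simp only [hinv s a ha]
  · obtain ⟨a, ha, h1⟩ := hrep s
    have h2 := hQ _ _ a ha (hg (rep s))
    rwa [h1] at h2

/-- If a subgroup `A` acts freely on `L ⧸ H`, there is an equivariant map `L ⧸ H → L`. -/
theorem exists_equivariant_map (A : Subgroup L)
    (hfree : ∀ x : L, ∀ a ∈ A, x⁻¹ * a * x ∈ H → a = 1) :
    ∃ q : L ⧸ H → L, ∀ a ∈ A, ∀ s, q (a • s) = a * q s := by
  obtain ⟨o, ho1, ho2, -⟩ := exists_orbit_choice (S := L ⧸ H) A (fun _ _ => True)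
    (fun s => ⟨1, A.one_mem, trivial⟩) fun _ _ _ _ _ => trivial
  choose σ hσA hσ using ho1
  have hmk : ∀ s, ((σ s * (o s).out : L) : L ⧸ H) = s := by
    intro s
    conv_rhs => rw [← hσ s, ← QuotientGroup.out_eq' (o s)]
    rfl
  refine ⟨fun s => σ s * (o s).out, fun a ha s => ?_⟩
  have h1 : ((σ (a • s) * (o s).out : L) : L ⧸ H) = (a * σ s * (o s).out : L) := by
    have h2 := hmk (a • s)
    rw [ho2 s a ha] at h2
    rw [h2, mul_assoc]
    conv_lhs => rw [← hmk s]
    rfl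
  -- `σ (a • s)` and `a * σ s` are elements of `A` carrying the same orbit representative to `a •
  -- s`; freeness makes them equal.
  have h3 := hfree (o s).out _ (A.mul_mem (A.inv_mem (hσA (a • s))) (A.mul_mem ha (hσA s))) (by
    have h4 := QuotientGroup.eq.1 h1
    convert h4 using 1
    group)
  simp only [ho2 s a ha]
  rw [inv_mul_eq_one.1 h3, mul_assoc]

theorem IsFreeFamily.cocycle_ext {ι : Type*} {A : ι → Subgroup L}
    (hA : IsFreeFamily A) {S M : Type*} [MulAction L S] [Group M] {D E : L → S → M}
    (hD : ∀ x y s, D (x * y) s = D x (y • s) * D y s)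
    (hE : ∀ x y s, E (x * y) s = E x (y • s) * E y s)
    (h : ∀ i, ∀ a ∈ A i, ∀ s, D a s = E a s) (x : L) (s : S) : D x s = E x s := by
  have hx : x ∈ ⨆ i, A i := by
    rw [hA.iSup_eq_top]
    trivial
  have one : ∀ F : L → S → M, (∀ x y s, F (x * y) s = F x (y • s) * F y s) → ∀ s, F 1 s = 1 := by
    intro F hF s
    have := hF 1 1 s
    rwa [mul_one, one_smul, left_eq_mul] at this
  refine Subgroup.iSup_induction A (C := fun x => ∀ s, D x s = E x s) hx h (fun s => ?_)
    (fun x y hx hy s => ?_) s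
  · rw [one D hD, one E hE]
  · rw [hD, hE, hx, hy]

/-- A subgroup of a free product which meets the conjugates of the factors trivially is free. -/
theorem IsFreeFamily.isFreeGroup_of_forall_conj {ι : Type} {A : ι → Subgroup L}
    (hA : IsFreeFamily A)
    (hfree : ∀ i, ∀ x : L, ∀ a ∈ A i, x⁻¹ * a * x ∈ H → a = 1) : IsFreeGroup H := by
  classical
  choose q hq using fun i => exists_equivariant_map H (A i) (hfree i)
  -- On each factor the cocycle is a coboundary with free values. `θ` turns it back into the
  -- tautological cocycle p(xs)⁻¹ x p(s), which is `h` itself for `h ∈ H` at the base coset. So `H`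
  -- embeds in a free group and is free by Nielsen–Schreier.
  obtain ⟨D, hD, hDA⟩ := hA.exists_cocycle (S := L ⧸ H) (P := FreeGroup (ι × (L ⧸ H)))
    (fun i a s => FreeGroup.of (i, a • s) * (FreeGroup.of (i, s))⁻¹) (fun i a ha b hb s => by
      rw [mul_smul]
      group)
  let p : L ⧸ H → L := fun s => if s = (1 : L) then 1 else s.out
  let θ : FreeGroup (ι × (L ⧸ H)) →* L := FreeGroup.lift fun j => (p j.2)⁻¹ * q j.1 j.2
  have hθ : ∀ x s, θ (D x s) = (p (x • s))⁻¹ * x * p s := by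
    refine hA.cocycle_ext (fun x y s => by rw [hD, map_mul])
      (fun x y s => by rw [mul_smul]; group) fun i a ha s => ?_
    rw [hDA i a ha, map_mul, map_inv]
    simp only [θ, FreeGroup.lift_apply_of]
    rw [hq i a ha s]
    group
  have hfix : ∀ h : H, (h : L) • ((1 : L) : L ⧸ H) = (1 : L) := by
    intro h
    change ((h * 1 : L) : L ⧸ H) = _
    rw [mul_one, QuotientGroup.eq]
    simp
  let φ : H →* FreeGroup (ι × (L ⧸ H)) := MonoidHom.mk' (fun h => D h ((1 : L) : L ⧸ H)) (by
    intro g h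
    rw [Subgroup.coe_mul, hD, hfix])
  have hφ : Function.Injective φ := by
    intro g h hgh
    have h1 : ∀ h : H, θ (φ h) = h := by
      intro h
      change θ (D h _) = _
      rw [hθ, hfix]
      simp [p]
    exact Subtype.ext (by rw [← h1 g, ← h1 h, hgh])
  exact IsFreeGroup.ofMulEquiv (MonoidHom.ofInjective hφ).symm

end Cosets

/-! ### A spanning tree in the quotient of the Bass–Serre tree by a subgroup -/

section Schreier

/-- Recursion along a parent map which decreases a rank away from the roots. -/
theorem exists_parent_recursion {X M : Type*} [Mul M] (r : X → ℕ) (root : X → Prop) (par : X → X)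
    (hpar : ∀ x, ¬ root x → r (par x) < r x) (g : X → M) :
    ∃ f : X → M, (∀ x, root x → f x = g x) ∧ ∀ x, ¬ root x → f x = g x * f (par x) := by
  classical
  let f : X → M := (measure r).wf.fix fun x ih =>
    if h : root x then g x else g x * ih (par x) (hpar x h)
  refine ⟨f, fun x hx => ?_, fun x hx => ?_⟩
  · simp only [f]
    rw [WellFounded.fix_eq, dif_pos hx]
  · simp only [f]
    rw [WellFounded.fix_eq, dif_neg hx]

variable {L : Type u} [Group L] (H : Subgroup L)

/-- Distance at most `n` from the base edge in the graph with edge set `L ⧸ H` whose vertices are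
the orbits of the two factors. -/
def Reaches (B : Bool → Subgroup L) : ℕ → Bool → L ⧸ H → Prop
  | 0, c, s => ∃ g ∈ B c, g • ((1 : L) : L ⧸ H) = s
  | n + 1, c, s => ∃ g ∈ B c, Reaches B n (!c) (g • s)

theorem Reaches.smul {B : Bool → Subgroup L} {n : ℕ} {c : Bool} {s : L ⧸ H}
    (h : Reaches H B n c s) {a : L} (ha : a ∈ B c) : Reaches H B n c (a • s) := by
  cases n with
  | zero =>
    obtain ⟨g, hg, rfl⟩ := h
    exact ⟨a * g, (B c).mul_mem ha hg, mul_smul _ _ _⟩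
  | succ n =>
    obtain ⟨g, hg, h⟩ := h
    refine ⟨g * a⁻¹, (B c).mul_mem hg ((B c).inv_mem ha), ?_⟩
    rwa [mul_smul, inv_smul_smul]

theorem Reaches.smul_iff {B : Bool → Subgroup L} {n : ℕ} {c : Bool} {s : L ⧸ H} {a : L}
    (ha : a ∈ B c) : Reaches H B n c (a • s) ↔ Reaches H B n c s := by
  refine ⟨fun h => ?_, fun h => h.smul H ha⟩
  have := h.smul H ((B c).inv_mem ha)
  rwa [inv_smul_smul] at this

/-- The graph is connected because the two factors generate `L`: an element of a factor moves an
edge to one with a common vertex. -/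
theorem exists_reaches {B : Bool → Subgroup L} (hB : IsFreeFamily B) (s : L ⧸ H) (c : Bool) :
    ∃ n, Reaches H B n c s := by
  have hswap : ∀ (s : L ⧸ H) c, (∃ n, Reaches H B n c s) → ∀ c', ∃ n, Reaches H B n c' s := by
    rintro s c ⟨n, h⟩ c'
    by_cases hc : c' = c
    · subst hc
      exact ⟨n, h⟩
    · refine ⟨n + 1, 1, (B c').one_mem, ?_⟩
      rwa [one_smul, Bool.not_eq.2 hc]
  induction s using QuotientGroup.induction_on with | _ x
  have hx : x ∈ ⨆ i, B i := by
    rw [hB.iSup_eq_top]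
    trivial
  have key : ∀ s : L ⧸ H, (∀ c, ∃ n, Reaches H B n c s) → ∀ c, ∃ n, Reaches H B n c (x • s) := by
    refine Subgroup.iSup_induction B
      (C := fun x => ∀ s : L ⧸ H, (∀ c, ∃ n, Reaches H B n c s) → ∀ c, ∃ n, Reaches H B n c (x • s))
      hx (fun i a ha s h => ?_) (fun s h => ?_) fun x y hx hy s h => ?_
    · obtain ⟨n, hn⟩ := h i
      exact hswap _ i ⟨n, hn.smul H ha⟩
    · simpa only [one_smul] using h
    · rw [mul_smul]
      exact hx _ (hy s h)
  have h1 := key ((1 : L) : L ⧸ H) (fun c => ⟨0, 1, (B c).one_mem, one_smul _ _⟩) c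
  rwa [show x • ((1 : L) : L ⧸ H) = ((x * 1 : L) : L ⧸ H) from rfl, mul_one] at h1

/-- A pair of systems of coset representatives of a subgroup of a free product of two factors, each
adapted to one of the factors, which agree on the edges of a spanning tree. -/
theorem exists_schreier_system {B : Bool → Subgroup L} (hB : IsFreeFamily B) :
    ∃ f : Bool → L ⧸ H → L, (∀ c s, (f c s : L ⧸ H) = s) ∧ (∀ c, f c (1 : L) = 1) ∧
      (∀ c s, ∀ a ∈ B c, f c (a • s) * (f c s)⁻¹ ∈ B c) ∧
      ∀ φ : Bool → L ⧸ H → Prop, (∀ c, φ c (1 : L)) →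
        (∀ c s, ∀ a ∈ B c, φ c s → φ c (a • s)) →
        (∀ c s, f c s = f (!c) s → φ (!c) s → φ c s) → ∀ c s, φ c s := by
  classical
  let e : L ⧸ H := (1 : L)
  let r : Bool → L ⧸ H → ℕ := fun c s => Nat.find (exists_reaches H hB s c)
  have hr : ∀ c s, Reaches H B (r c s) c s := fun c s => Nat.find_spec (exists_reaches H hB s c)
  have hr' : ∀ c s n, Reaches H B n c s → r c s ≤ n := fun c s n h => Nat.find_min' _ h
  have hrinv : ∀ c s, ∀ a ∈ B c, r c (a • s) = r c s := fun c s a ha =>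
    le_antisymm (hr' _ _ _ ((hr c s).smul H ha)) (hr' _ _ _ ((Reaches.smul_iff H ha).1 (hr c _)))
  let root : Bool → L ⧸ H → Prop := fun c s => Reaches H B 0 c s
  have hrootinv : ∀ c s, ∀ a ∈ B c, (root c (a • s) ↔ root c s) := fun c s a ha =>
    Reaches.smul_iff H ha
  -- `t` is an admissible parent edge of the vertex of colour `c` on `s`: the base edge if the
  -- vertex lies on it, otherwise an edge whose other end is nearer to the base.
  let Q : Bool → L ⧸ H → L ⧸ H → Prop := fun c s t =>
    (root c s → t = e) ∧ (¬ root c s → r (!c) t < r c s)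
  have hQ : ∀ c, ∀ s, ∃ a ∈ B c, Q c s (a • s) := by
    intro c s
    by_cases hroot : root c s
    · obtain ⟨g, hg, h⟩ := hroot
      refine ⟨g⁻¹, (B c).inv_mem hg, fun _ => ?_, fun h' => absurd ⟨g, hg, h⟩ h'⟩
      rw [← h, inv_smul_smul]
    · have h1 := hr c s
      obtain ⟨m, hm⟩ : ∃ m, r c s = m + 1 := by
        refine Nat.exists_eq_succ_of_ne_zero fun h0 => hroot ?_
        rwa [h0] at h1
      rw [hm] at h1
      obtain ⟨g, hg, h2⟩ := h1
      refine ⟨g, hg, fun h => absurd h hroot, fun _ => ?_⟩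
      rw [hm]
      exact Nat.lt_succ_of_le (hr' _ _ _ h2)
  choose pt hpt1 hpt2 hpt3 using fun c => exists_orbit_choice (B c) (Q c) (hQ c)
    fun s t a ha h => by
      simp only [Q, hrootinv c s a ha, hrinv c s a ha]
      exact h
  -- Taking the identity on the parent edge itself makes the representatives of both colours agree
  -- on tree edges.
  have hσ : ∀ c s, ∃ a ∈ B c, a • pt c s = s ∧ (pt c s = s → a = 1) := by
    intro c s
    by_cases h : pt c s = s
    · exact ⟨1, (B c).one_mem, by rw [one_smul, h], fun _ => rfl⟩
    · obtain ⟨a, ha, h1⟩ := hpt1 c s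
      exact ⟨a, ha, h1, fun h' => absurd h' h⟩
  choose σ hσB hσ hσ1 using hσ
  obtain ⟨f', hf1, hf2⟩ := exists_parent_recursion (X := Bool × L ⧸ H) (fun x => r x.1 x.2)
    (fun x => root x.1 x.2) (fun x => (!x.1, pt x.1 x.2)) (fun x hx => (hpt3 x.1 x.2).2 hx)
    (fun x => σ x.1 x.2)
  let f : Bool → L ⧸ H → L := fun c s => f' (c, s)
  have hfroot : ∀ c s, root c s → f c s = σ c s := fun c s h => hf1 (c, s) h
  have hfstep : ∀ c s, ¬ root c s → f c s = σ c s * f (!c) (pt c s) := fun c s h => hf2 (c, s) h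
  have hpte : ∀ c s, root c s → pt c s = e := fun c s h => (hpt3 c s).1 h
  have hroote : ∀ c, root c e := fun c => ⟨1, (B c).one_mem, one_smul _ _⟩
  have hptroot : ∀ c s, root c (pt c s) ↔ root c s := by
    intro c s
    conv_rhs => rw [← hσ c s]
    exact (hrootinv c _ _ (hσB c s)).symm
  have hptpt : ∀ c s, pt c (pt c s) = pt c s := by
    intro c s
    conv_rhs => rw [← hσ c s]
    exact (hpt2 c _ _ (hσB c s)).symm
  refine ⟨f, ?_, fun c => ?_, fun c s a ha => ?_, fun φ h1 h2 h3 => ?_⟩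
  · have key : ∀ n c s, r c s = n → (f c s : L ⧸ H) = s := by
      intro n
      induction n using Nat.strong_induction_on with | _ n ih
      intro c s hn
      by_cases hroot : root c s
      · rw [hfroot c s hroot]
        have := hσ c s
        rw [hpte c s hroot] at this
        conv_rhs => rw [← this]
        change _ = ((σ c s * 1 : L) : L ⧸ H)
        rw [mul_one]
      · rw [hfstep c s hroot]
        have h4 := ih _ (by rw [← hn]; exact (hpt3 c s).2 hroot) (!c) (pt c s) rfl
        conv_rhs => rw [← hσ c s, ← h4]
        rfl
    exact fun c s => key _ c s rfl
  · change f c e = 1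
    rw [hfroot c e (hroote c)]
    exact hσ1 c e (hpte c e (hroote c))
  · by_cases hroot : root c s
    · rw [hfroot c s hroot, hfroot c _ ((hrootinv c s a ha).2 hroot)]
      exact (B c).mul_mem (hσB _ _) ((B c).inv_mem (hσB _ _))
    · rw [hfstep c s hroot, hfstep c _ (fun h => hroot ((hrootinv c s a ha).1 h)), hpt2 c s a ha]
      convert (B c).mul_mem (hσB c (a • s)) ((B c).inv_mem (hσB c s)) using 1
      group
  · have key : ∀ n c s, r c s = n → φ c s := by
      intro n
      induction n using Nat.strong_induction_on with | _ n ih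
      intro c s hn
      rw [← hσ c s]
      refine h2 c _ _ (hσB c s) ?_
      by_cases hroot : root c s
      · rw [hpte c s hroot]
        exact h1 c
      · refine h3 c _ ?_ (ih _ (by rw [← hn]; exact (hpt3 c s).2 hroot) (!c) (pt c s) rfl)
        rw [hfstep c _ (fun h => hroot ((hptroot c s).1 h)), hσ1 c _ (hptpt c s), hptpt, one_mul]
    exact fun c s => key _ c s rfl

end Schreier
/-- The intersection of a subgroup `H` of a free product with a factor is a free factor of `H`. -/
theorem exists_isFreeProduct_subgroupOf {L : Type u} [Group L] {A B : Subgroup L}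
    (hAB : IsFreeProduct A B) (H : Subgroup L) :
    ∃ K : Subgroup H, IsFreeProduct (A.subgroupOf H) K := by
  classical
  let C : Bool → Subgroup L := fun c => cond c A B
  have hC : IsFreeFamily C := IsFreeFamily.isFreeProduct_iff.1 hAB
  obtain ⟨f, hf, hf1, hfC, hfind⟩ := exists_schreier_system H hC
  let e : L ⧸ H := (1 : L)
  have hmem : ∀ c x s, (f c (x • s))⁻¹ * x * f c s ∈ H := by
    intro c x s
    rw [mul_assoc, ← QuotientGroup.eq, hf]
    conv_lhs => rw [← hf c s]
    rfl
  -- The tautological cocycle read in the representatives of colour `c`. The elements `U` compare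
  -- the two colours and are trivial on tree edges.
  let k : Bool → L → L ⧸ H → H := fun c x s => ⟨_, hmem c x s⟩
  have hk : ∀ c x y s, k c (x * y) s = k c x (y • s) * k c y s := by
    intro c x y s
    apply Subtype.ext
    simp only [k, Subgroup.coe_mul, mul_smul]
    group
  have hUmem : ∀ s, (f false s)⁻¹ * f true s ∈ H := fun s => by
    rw [← QuotientGroup.eq, hf, hf]
  let U : L ⧸ H → H := fun s => ⟨_, hUmem s⟩
  have hUk : ∀ x s, U (x • s) * k true x s * (U s)⁻¹ = k false x s := by
    intro x s
    apply Subtype.ext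
    simp only [k, U, Subgroup.coe_mul, Subgroup.coe_inv]
    group
  let root : L ⧸ H → Prop := fun s => ∃ a ∈ A, a • e = s
  have hroot : ∀ s, ∀ a ∈ A, (root (a • s) ↔ root s) := by
    intro s a ha
    constructor
    · rintro ⟨b, hb, h⟩
      exact ⟨a⁻¹ * b, A.mul_mem (A.inv_mem ha) hb, by rw [mul_smul, h, inv_smul_smul]⟩
    · rintro ⟨b, hb, rfl⟩
      exact ⟨a * b, A.mul_mem ha hb, mul_smul _ _ _⟩
  have hrootA : ∀ s, root s → f true s ∈ A := by
    rintro s ⟨a, ha, rfl⟩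
    have := hfC true e a ha
    rwa [hf1, inv_one, mul_one] at this
  -- Generators of all Kurosh factors other than `A ∩ H`: the edge elements, the stabilizers of the
  -- `B`-vertices, and those of the `A`-vertices other than the base one.
  let gen : Set H := {h | (∃ s, U s = h) ∨ (∃ s, f false s * h * (f false s)⁻¹ ∈ B) ∨
    ∃ s, ¬ root s ∧ f true s * h * (f true s)⁻¹ ∈ A}
  let K : Subgroup H := Subgroup.closure gen
  have hUK : ∀ s, U s ∈ K := fun s => Subgroup.subset_closure (Or.inl ⟨s, rfl⟩)
  have hkB : ∀ s, ∀ b ∈ B, k false b s ∈ K := by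
    intro s b hb
    refine Subgroup.subset_closure (Or.inr (Or.inl ⟨s, ?_⟩))
    convert B.mul_mem (B.inv_mem (hfC false s b hb)) hb using 1
    simp only [k]
    group
  have hkA : ∀ s, ∀ a ∈ A, f true s * k true a s * (f true s)⁻¹ ∈ A := by
    intro s a ha
    convert A.mul_mem (A.inv_mem (hfC true s a ha)) ha using 1
    simp only [k]
    group
  have hkAK : ∀ s, ∀ a ∈ A, ¬ root s → k true a s ∈ K := fun s a ha h =>
    Subgroup.subset_closure (Or.inr (Or.inr ⟨s, h, hkA s a ha⟩))
  have hkAA : ∀ s, ∀ a ∈ A, root s → k true a s ∈ A.subgroupOf H := by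
    intro s a ha h
    rw [Subgroup.mem_subgroupOf]
    convert A.mul_mem (A.mul_mem (A.inv_mem (hrootA s h)) (hkA s a ha)) (hrootA s h) using 1
    group
  -- Total functions with the default value 1; multiplicativity is used only inside the respective
  -- subgroup.
  let iA : H → Coprod (A.subgroupOf H) K := fun h =>
    if hh : h ∈ A.subgroupOf H then Coprod.inl ⟨h, hh⟩ else 1
  let iK : H → Coprod (A.subgroupOf H) K := fun h =>
    if hh : h ∈ K then Coprod.inr ⟨h, hh⟩ else 1
  have hiA : ∀ h (hh : h ∈ A.subgroupOf H), iA h = Coprod.inl ⟨h, hh⟩ := fun h hh => dif_pos hh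
  have hiK : ∀ h (hh : h ∈ K), iK h = Coprod.inr ⟨h, hh⟩ := fun h hh => dif_pos hh
  have hiAmul : ∀ g h, g ∈ A.subgroupOf H → h ∈ A.subgroupOf H → iA (g * h) = iA g * iA h := by
    intro g h hg hh
    rw [hiA g hg, hiA h hh, hiA _ (mul_mem hg hh), ← map_mul]
    rfl
  have hiKmul : ∀ g h, g ∈ K → h ∈ K → iK (g * h) = iK g * iK h := by
    intro g h hg hh
    rw [hiK g hg, hiK h hh, hiK _ (mul_mem hg hh), ← map_mul]
    rfl
  have hiA1 : iA 1 = 1 := by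
    rw [hiA 1 (one_mem _)]
    exact map_one Coprod.inl
  have hiK1 : iK 1 = 1 := by
    rw [hiK 1 (one_mem _)]
    exact map_one Coprod.inr
  let iR : L ⧸ H → H → Coprod (A.subgroupOf H) K := fun s h => if root s then iA h else iK h
  -- A lift of the cocycle `k false` to the abstract free product: on `A` it is `k true` conjugated
  -- by the edge elements. Its values at the base edge give an inverse of the natural map to `H`.
  let d : Bool → L → L ⧸ H → Coprod (A.subgroupOf H) K := fun c x s =>
    match c with
    | true => iK (U (x • s)) * iR s (k true x s) * (iK (U s))⁻¹
    | false => iK (k false x s)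
  obtain ⟨D, hD, hDC⟩ := hC.exists_cocycle d (by
    rintro (_ | _) a ha b hb s
    · change iK _ = iK _ * iK _
      rw [hk, hiKmul _ _ (hkB _ _ ha) (hkB _ _ hb)]
    · change iK _ * iR _ _ * _ = iK _ * iR _ _ * _ * (iK _ * iR _ _ * _)
      rw [hk, mul_smul]
      by_cases h : root s
      · have h' : root (b • s) := (hroot s b hb).2 h
        simp only [iR, if_pos h, if_pos h']
        rw [hiAmul _ _ (hkAA _ _ ha h') (hkAA _ _ hb h)]
        group
      · have h' : ¬ root (b • s) := fun h' => h ((hroot s b hb).1 h')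
        simp only [iR, if_neg h, if_neg h']
        rw [hiKmul _ _ (hkAK _ _ ha h') (hkAK _ _ hb h)]
        group)
  have hDA : ∀ a ∈ A, ∀ s, D a s = iK (U (a • s)) * iR s (k true a s) * (iK (U s))⁻¹ :=
    fun a ha s => hDC true a ha s
  have hDB : ∀ b ∈ B, ∀ s, D b s = iK (k false b s) := fun b hb s => hDC false b hb s
  have hD1 : ∀ s, D 1 s = 1 := by
    intro s
    have := hD 1 1 s
    rwa [mul_one, one_smul, left_eq_mul] at this
  let ℓ : Coprod (A.subgroupOf H) K →* H := Coprod.lift (A.subgroupOf H).subtype K.subtype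
  have hℓA : ∀ h ∈ A.subgroupOf H, ℓ (iA h) = h := fun h hh => by
    rw [hiA h hh]
    exact Coprod.lift_apply_inl _ _ _
  have hℓK : ∀ h ∈ K, ℓ (iK h) = h := fun h hh => by
    rw [hiK h hh]
    exact Coprod.lift_apply_inr _ _ _
  have hℓD : ∀ x s, ℓ (D x s) = k false x s := by
    refine hC.cocycle_ext (D := fun x s => ℓ (D x s)) (E := k false)
      (fun x y s => by rw [hD, map_mul]) (hk false) ?_
    rintro (_ | _) a ha s
    · rw [hDB a ha, hℓK _ (hkB s a ha)]
    · rw [hDA a ha, map_mul, map_mul, map_inv, hℓK _ (hUK _), hℓK _ (hUK _), ← hUk]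
      congr 2
      by_cases h : root s
      · simp only [iR, if_pos h]
        exact hℓA _ (hkAA s a ha h)
      · simp only [iR, if_neg h]
        exact hℓK _ (hkAK s a ha h)
  have hfe : ∀ c s, f c s • e = s := by
    intro c s
    conv_rhs => rw [← hf c s]
    change ((f c s * 1 : L) : L ⧸ H) = _
    rw [mul_one]
  have hfe' : ∀ c s, (f c s)⁻¹ • s = e := fun c s => by
    rw [inv_smul_eq_iff, hfe]
  have hUe : U e = 1 := by
    apply Subtype.ext
    simp [U, e, hf1]
  -- Induction along the spanning tree. This value on the representatives is what identifies `φ` on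
  -- the generators of `K`.
  have htree : ∀ c s, D (f c s) e = cond c (iK (U s)) 1 := by
    refine hfind _ ?_ ?_ ?_
    · rintro (_ | _)
      · rw [hf1, hD1]
        rfl
      · rw [hf1, hD1]
        change 1 = iK (U e)
        rw [hUe, hiK1]
    · intro c s a ha h
      set a' := f c (a • s) * (f c s)⁻¹ with ha'
      have h1 : f c (a • s) = a' * f c s := by rw [ha']; group
      have h2 : a' • s = a • s := by rw [ha', mul_smul, hfe', hfe]
      have ha'C : a' ∈ C c := hfC c s a ha
      have h3 : k c a' s = 1 := by
        apply Subtype.ext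
        simp only [k, h2, h1, Subgroup.coe_one]
        group
      rw [h1, hD, hfe, h]
      cases c
      · rw [hDB a' ha'C, h3, hiK1]
        rfl
      · rw [hDA a' ha'C, h3, h2]
        have : iR s 1 = 1 := by
          simp only [iR, hiA1, hiK1, ite_self]
        rw [this]
        change iK (U (a • s)) * 1 * (iK (U s))⁻¹ * iK (U s) = iK (U (a • s))
        group
    · intro c s hcs h
      rw [hcs, h]
      have hU1 : iK (U s) = 1 := by
        have : U s = 1 := by
          apply Subtype.ext
          cases c
          · simp only [U, hcs]
            simp
          · simp only [U, hcs]
            simp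
        rw [this, hiK1]
      cases c <;> simp [hU1]
  have hDinv : ∀ x y s, D (x⁻¹ * y) s = (D x (x⁻¹ • y • s))⁻¹ * D y s := by
    intro x y s
    have h1 := hD x x⁻¹ (y • s)
    rw [mul_inv_cancel, hD1] at h1
    rw [hD, eq_inv_of_mul_eq_one_right h1.symm]
  have hHe : ∀ h : H, (h : L) • e = e := by
    intro h
    change ((h * 1 : L) : L ⧸ H) = _
    rw [mul_one, QuotientGroup.eq]
    simp
  let φ : H →* Coprod (A.subgroupOf H) K := MonoidHom.mk' (fun h => D h e) (by
    intro g h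
    rw [Subgroup.coe_mul, hD, hHe])
  have hℓφ : ∀ h, ℓ (φ h) = h := by
    intro h
    change ℓ (D h e) = h
    rw [hℓD]
    apply Subtype.ext
    simp only [k, hHe]
    simp [e, hf1]
  have hconj : ∀ c s (x : L), x • s = s →
      D ((f c s)⁻¹ * x * f c s) e = (D (f c s) e)⁻¹ * D x s * D (f c s) e := by
    intro c s x hx
    rw [mul_assoc, hDinv, mul_smul, hfe, hx, hfe', hD, hfe, mul_assoc]
  have hstab : ∀ c s (h : H) (x : L), f c s * h * (f c s)⁻¹ = x → x • s = s := by
    rintro c s h x rfl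
    rw [mul_smul, mul_smul, hfe', hHe, hfe]
  have hφK : ∀ h (hh : h ∈ K), φ h = Coprod.inr ⟨h, hh⟩ := by
    intro h hh
    refine Subgroup.closure_induction (p := fun h hh => φ h = Coprod.inr ⟨h, hh⟩) ?_ ?_ ?_ ?_ hh
    · intro h hgen
      rw [← hiK]
      rcases hgen with ⟨s, rfl⟩ | ⟨s, hs⟩ | ⟨s, hsroot, hs⟩
      · change D ((f false s)⁻¹ * f true s) e = _
        rw [hDinv, hfe, hfe', htree, htree]
        simp
      · have hst := hstab false s h _ rfl
        set x := f false s * h * (f false s)⁻¹ with hx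
        have h1 : (h : L) = (f false s)⁻¹ * x * f false s := by rw [hx]; group
        change D h e = _
        rw [h1, hconj _ _ _ hst, hDB x hs, htree]
        simp only [cond_false, inv_one, one_mul, mul_one]
        congr 1
        apply Subtype.ext
        simp only [k, hst, h1]
      · have hst := hstab true s h _ rfl
        set x := f true s * h * (f true s)⁻¹ with hx
        have h1 : (h : L) = (f true s)⁻¹ * x * f true s := by rw [hx]; group
        change D h e = _
        rw [h1, hconj _ _ _ hst, hDA x hs, htree, hst]
        simp only [cond_true, iR, if_neg hsroot]
        have h2 : k true x s = h := by
          apply Subtype.ext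
          simp only [k, hst, h1]
        rw [h2]
        group
    · rw [map_one]
      exact (map_one Coprod.inr).symm
    · intro g h hg hh h1 h2
      rw [map_mul, h1, h2, ← map_mul]
      rfl
    · intro g hg h1
      rw [map_inv, h1, ← map_inv]
      rfl
  have hφA : ∀ h (hh : h ∈ A.subgroupOf H), φ h = Coprod.inl ⟨h, hh⟩ := by
    intro h hh
    rw [← hiA]
    change D h e = _
    rw [hDA h hh, hHe, hUe, hiK1]
    have : root e := ⟨1, A.one_mem, one_smul _ _⟩
    simp only [iR, if_pos this, inv_one, mul_one, one_mul]
    congr 1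
    apply Subtype.ext
    simp only [k, hHe]
    simp [e, hf1]
  refine ⟨K, ?_, fun h => ⟨φ h, hℓφ h⟩⟩
  have h1 : φ.comp ℓ = MonoidHom.id _ :=
    Coprod.hom_ext (MonoidHom.ext fun a => hφA a a.2) (MonoidHom.ext fun b => hφK b b.2)
  exact Function.LeftInverse.injective (g := φ) fun x => DFunLike.congr_fun h1 x

/-! ### Freely indecomposable subgroups of free products -/

/-- A nontrivial freely indecomposable free group is infinite cyclic. -/
theorem FreelyIndecomposable.nonempty_mulEquiv_int {G : Type u} [Group G] [Nontrivial G]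
    [IsFreeGroup G] (h : FreelyIndecomposable G) : Nonempty (G ≃* Multiplicative ℤ) := by
  classical
  obtain ⟨ι, ⟨b⟩⟩ := IsFreeGroup.nonempty_basis (G := G)
  have hsub : Subsingleton ι := by
    refine ⟨fun i j => by_contra fun hij => ?_⟩
    have hne : ∀ k : ι, b k ≠ 1 := by
      intro k hk
      have h1 : FreeGroupBasis.lift b (fun _ => Multiplicative.ofAdd (1 : ℤ)) (b k)
          = Multiplicative.ofAdd 1 := by simp
      rw [hk, map_one] at h1
      exact absurd h1.symm (by decide)
    -- Two basis elements would give a nontrivial splitting into the span of one and the span of the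
    -- others.
    let X : Subgroup G := Subgroup.closure {b i}
    let Y : Subgroup G := Subgroup.closure (b '' {i}ᶜ)
    have hX : b i ∈ X := Subgroup.subset_closure rfl
    have hY : ∀ k, k ≠ i → b k ∈ Y := fun k hk => Subgroup.subset_closure ⟨k, hk, rfl⟩
    have hXY : IsFreeProduct X Y := by
      rw [IsFreeFamily.isFreeProduct_iff]
      refine IsFreeFamily.mk_pair ?_ fun {Z} _ f g => ?_
      · let q : G →* (X ⊔ Y : Subgroup G) := FreeGroupBasis.lift b fun k => ⟨b k, by
          by_cases hk : k = i
          · subst hk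
            exact Subgroup.mem_sup_left hX
          · exact Subgroup.mem_sup_right (hY k hk)⟩
        have hq : (X ⊔ Y).subtype.comp q = MonoidHom.id G := b.ext_hom _ _ fun k => by
          simp [q]
        rw [eq_top_iff]
        intro x _
        have := DFunLike.congr_fun hq x
        change ((q x : (X ⊔ Y : Subgroup G)) : G) = x at this
        rw [← this]
        exact (q x).2
      · let F : G →* Z := FreeGroupBasis.lift b fun k =>
          if hk : k = i then f ⟨b i, hX⟩ else g ⟨b k, hY k hk⟩
        have hFi : F (b i) = f ⟨b i, hX⟩ := by simp [F]
        have hFk : ∀ k (hk : k ≠ i), F (b k) = g ⟨b k, hY k hk⟩ := fun k hk => by simp [F, hk]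
        refine ⟨F, ?_, ?_⟩
        · rintro ⟨a, ha⟩
          refine Subgroup.closure_induction (p := fun a ha => F a = f ⟨a, ha⟩) ?_ ?_ ?_ ?_ ha
          · rintro _ rfl
            exact hFi
          · rw [map_one]
            exact (map_one f).symm
          · intro x y hx hy h1 h2
            rw [map_mul, h1, h2, ← map_mul]
            rfl
          · intro x hx h1
            rw [map_inv, h1, ← map_inv]
            rfl
        · rintro ⟨a, ha⟩
          refine Subgroup.closure_induction (p := fun a ha => F a = g ⟨a, ha⟩) ?_ ?_ ?_ ?_ ha
          · rintro _ ⟨k, hk, rfl⟩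
            exact hFk k hk
          · rw [map_one]
            exact (map_one g).symm
          · intro x y hx hy h1 h2
            rw [map_mul, h1, h2, ← map_mul]
            rfl
          · intro x hx h1
            rw [map_inv, h1, ← map_inv]
            rfl
    rcases h X Y hXY with h1 | h1
    · rw [h1] at hX
      exact hne i (Subgroup.mem_bot.1 hX)
    · have := hY j (Ne.symm hij)
      rw [h1] at this
      exact hne j (Subgroup.mem_bot.1 this)
  rcases isEmpty_or_nonempty ι with hι | ⟨⟨i⟩⟩
  · exfalso
    obtain ⟨x, hx⟩ := exists_ne (1 : G)
    exact hx (DFunLike.congr_fun (b.ext_hom (MonoidHom.id G) 1 fun i => isEmptyElim i) x)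
  · have : Unique ι := ⟨⟨i⟩, fun j => Subsingleton.elim _ _⟩
    exact ⟨b.repr.trans FreeGroup.mulEquivIntOfUnique⟩

theorem IsFreeProduct.eq_top_of_eq_bot {L : Type u} [Group L] {A B : Subgroup L}
    (h : IsFreeProduct A B) (hB : B = ⊥) : A = ⊤ := by
  have h1 := (IsFreeFamily.isFreeProduct_iff.1 h).iSup_eq_top
  rw [iSup_bool_eq, hB] at h1
  simpa using h1

/-- A subgroup which is freely indecomposable relative to a nontrivial subgroup of a free factor is
contained in this factor. -/
theorem FreelyIndecomposableRel.le_of_isFreeProduct {L : Type u} [Group L] {A B C H : Subgroup L}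
    (hAB : IsFreeProduct A B) (hCH : C ≤ H) (hCA : C ≤ A) (hC : C ≠ ⊥)
    (h : FreelyIndecomposableRel (C.subgroupOf H)) : H ≤ A := by
  obtain ⟨K, hK⟩ := exists_isFreeProduct_subgroupOf hAB H
  rcases h _ K hK fun c hc => hCA hc with h1 | h1
  -- `A ∩ H` contains the nontrivial subgroup `C`, so it is the complementary factor that vanishes.
  · exfalso
    refine hC (eq_bot_iff.2 fun c hc => ?_)
    have h2 : (⟨c, hCH hc⟩ : H) ∈ A.subgroupOf H := hCA hc
    rw [h1] at h2
    exact congrArg Subtype.val (Subgroup.mem_bot.1 h2)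
  · exact Subgroup.subgroupOf_eq_top.1 (hK.eq_top_of_eq_bot h1)

/-- A freely indecomposable subgroup of a free product, not infinite cyclic, is conjugate into a
factor. -/
theorem IsFreeFamily.exists_conj_mem {L : Type u} [Group L] {ι : Type} {A : ι → Subgroup L}
    (hA : IsFreeFamily A) (H : Subgroup L) [Nontrivial H] (hH : FreelyIndecomposable H)
    (hZ : ¬ Nonempty (H ≃* Multiplicative ℤ)) :
    ∃ (i : ι) (g : L), ∀ h ∈ H, g * h * g⁻¹ ∈ A i := by
  by_cases hfree : ∀ i, ∀ x : L, ∀ a ∈ A i, x⁻¹ * a * x ∈ H → a = 1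
  · have := hA.isFreeGroup_of_forall_conj H hfree
    exact absurd hH.nonempty_mulEquiv_int hZ
  · push Not at hfree
    -- `H` meets the conjugate of `A i` by `x⁻¹` nontrivially. This intersection is a free factor of
    -- `H`, hence all of `H`.
    obtain ⟨i, x, a, ha, hax, ha1⟩ := hfree
    have hconj := (hA.map (MulAut.conj x⁻¹)).isFreeProduct_compl i
    obtain ⟨K, hK⟩ := exists_isFreeProduct_subgroupOf hconj H
    refine ⟨i, x, fun h hh => ?_⟩
    rcases hH _ K hK with h1 | h1
    · exfalso
      have h2 : (⟨x⁻¹ * a * x, hax⟩ : H) ∈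
          ((A i).map (MulAut.conj x⁻¹).toMonoidHom).subgroupOf H :=
        ⟨a, ha, by simp⟩
      rw [h1] at h2
      have h3 : x⁻¹ * a * x = 1 := congrArg Subtype.val (Subgroup.mem_bot.1 h2)
      refine ha1 ?_
      calc a = x * (x⁻¹ * a * x) * x⁻¹ := by group
        _ = 1 := by rw [h3]; group
    · obtain ⟨b, hb, hbh⟩ := Subgroup.subgroupOf_eq_top.1 (hK.eq_top_of_eq_bot h1) hh
      rw [← hbh]
      simpa [mul_assoc] using hb

/-! ### Rigidity of Grushko decompositions under relative automorphisms -/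

namespace IsGrushkoDecomposition

variable {L : Type u} [Group L] {H L₀ : Subgroup L} {n r : ℕ} {G : Fin n → Subgroup L}
  {t : Fin r → L}

/-- The factors of a Grushko decomposition. -/
def factor (L₀ : Subgroup L) (G : Fin n → Subgroup L) (t : Fin r → L) :
    Option (Option (Fin n)) → Subgroup L
  | none => L₀
  | some none => (FreeGroup.lift t).range
  | some (some i) => G i

theorem isFreeFamily (h : IsGrushkoDecomposition H L₀ G t) : IsFreeFamily (factor L₀ G t) where
  iSup_eq_top := by
    rw [eq_top_iff]
    intro x hx
    clear hx
    obtain ⟨y, rfl⟩ := h.bijective.2 x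
    have hle := fun o => le_iSup (factor L₀ G t) o
    induction y using Coprod.induction_on with
    | inl y =>
      induction y using Coprod.induction_on with
      | inl y => simpa using hle none y.2
      | inr y =>
        induction y using CoprodI.induction_on with
        | one => simp
        | of i y => simpa using hle (some (some i)) y.2
        | mul y z hy hz =>
          simp only [map_mul]
          exact mul_mem hy hz
      | mul y z hy hz =>
        simp only [map_mul]
        exact mul_mem hy hz
    | inr y =>
      rw [Coprod.lift_apply_inr]
      exact hle (some none) ⟨y, rfl⟩
    | mul y z hy hz =>
      simp only [map_mul]
      exact mul_mem hy hz
  exists_lift {X} _ f := by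
    let e := MulEquiv.ofBijective _ h.bijective
    let φ : Coprod (Coprod L₀ (CoprodI fun i => G i)) (FreeGroup (Fin r)) →* X :=
      Coprod.lift (Coprod.lift (f none) (CoprodI.lift fun i => f (some (some i))))
        ((f (some none)).comp (FreeGroup.lift t).rangeRestrict)
    have hφ : ∀ y x, e y = x → φ (e.symm x) = φ y := by
      rintro y _ rfl
      rw [MulEquiv.symm_apply_apply]
    refine ⟨φ.comp e.symm.toMonoidHom, ?_⟩
    rintro (_ | _ | i) ⟨a, ha⟩
    · refine (hφ (Coprod.inl (Coprod.inl ⟨a, ha⟩)) a ?_).trans ?_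
      · simp [e]
      · exact (Coprod.lift_apply_inl _ _ _).trans (Coprod.lift_apply_inl _ _ _)
    · obtain ⟨y, rfl⟩ := ha
      refine (hφ (Coprod.inr y) _ ?_).trans ?_
      · simp [e]
      · simp only [φ, Coprod.lift_apply_inr]
        rfl
    · refine (hφ (Coprod.inl (Coprod.inr (CoprodI.of (i := i) ⟨a, ha⟩))) a ?_).trans ?_
      · simp [e]
      · exact ((Coprod.lift_apply_inl _ _ _).trans (Coprod.lift_apply_inr _ _ _)).trans
          (CoprodI.lift_of _ _)

theorem lift_injective (h : IsGrushkoDecomposition H L₀ G t) :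
    Function.Injective (FreeGroup.lift t) := by
  intro x y hxy
  exact Coprod.inr_injective (h.bijective.1 (by simpa using hxy))

/-- Automorphisms fixing `H` preserve the base of a Grushko decomposition relative to `H`. -/
theorem map_mem (h : IsGrushkoDecomposition H L₀ G t) (hH : H ≠ ⊥) (α : L ≃* L)
    (hα : ∀ x ∈ H, α x = x) {x : L} (hx : x ∈ L₀) : α x ∈ L₀ := by
  -- The image of `L₀` under the inverse automorphism is a free factor still containing `H`, so
  -- relative indecomposability puts `L₀` inside it.
  have h1 := (h.isFreeFamily.map α.symm).isFreeProduct_compl none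
  have h2 : H ≤ L₀.map α.symm.toMonoidHom := fun y hy => ⟨y, h.le hy, by
    change α.symm y = y
    rw [MulEquiv.symm_apply_eq, hα y hy]⟩
  obtain ⟨y, hy, hyx⟩ :=
    FreelyIndecomposableRel.le_of_isFreeProduct h1 h.le h2 hH h.indecomposable_base hx
  have h3 : α.symm y = x := hyx
  rw [← h3, MulEquiv.apply_symm_apply]
  exact hy

/-- A homomorphism which is trivial on the freely indecomposable factors of a Grushko decomposition
relative to `H` is trivial on their images under automorphisms fixing `H`. -/
theorem map_eq_one (h : IsGrushkoDecomposition H L₀ G t) (hH : H ≠ ⊥) (α : L ≃* L)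
    (hα : ∀ x ∈ H, α x = x) {X : Type*} [Group X] (ψ : L →* X) (hψ : ∀ i, ∀ x ∈ G i, ψ x = 1)
    (i : Fin n) {x : L} (hx : x ∈ G i) : ψ (α x) = 1 := by
  have := h.nontrivial i
  obtain ⟨j, g, hg⟩ := (h.isFreeFamily.map α.symm).exists_conj_mem (G i) (h.indecomposable i)
    (h.not_infinite_cyclic i)
  have hg' : ∀ y ∈ G i, α (g * y * g⁻¹) ∈ factor L₀ G t j := by
    intro y hy
    obtain ⟨z, hz, hzy⟩ := hg y hy
    rw [← hzy]
    change α (α.symm z) ∈ _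
    rwa [MulEquiv.apply_symm_apply]
  obtain ⟨y₀, hy₀⟩ := exists_ne (1 : G i)
  rcases j with _ | _ | j
  -- A conjugate of `G i` would lie in `L₀`, but the projection of `L` onto `G i` kills `L₀` and is
  -- injective on conjugates of `G i`.
  · exfalso
    obtain ⟨F, hF, hF'⟩ := h.isFreeFamily.exists_lift_single (some (some i))
      (MonoidHom.id (G i))
    have hαs : ∀ x ∈ H, α.symm x = x := fun x hx => by
      rw [MulEquiv.symm_apply_eq, hα x hx]
    have h1 := h.map_mem hH α.symm hαs (hg' y₀ y₀.2)
    rw [MulEquiv.symm_apply_apply] at h1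
    have h2 := hF' none (by simp) _ h1
    rw [map_mul, map_mul, map_inv, hF y₀] at h2
    have h3 : (MonoidHom.id (G i)) y₀ = (F g)⁻¹ * (F g * y₀ * (F g)⁻¹) * F g := by
      change y₀ = _
      group
    rw [show F g * y₀ * (F g)⁻¹ = 1 from h2] at h3
    exact hy₀ (h3.trans (by group))
  -- `G i` would embed in a free group and so, being indecomposable, be infinite cyclic.
  · exfalso
    let e : FreeGroup (Fin r) ≃* (FreeGroup.lift t).range :=
      MonoidHom.ofInjective h.lift_injective
    let κ : G i →* (FreeGroup.lift t).range :=
      ((α.toMonoidHom.comp (MulAut.conj g).toMonoidHom).comp (G i).subtype).codRestrict _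
        fun y => hg' y y.2
    have hκ : Function.Injective κ := by
      intro y z hyz
      have h1 : α (g * y * g⁻¹) = α (g * z * g⁻¹) := congrArg Subtype.val hyz
      exact Subtype.ext (by simpa using α.injective h1)
    have hinj : Function.Injective (e.symm.toMonoidHom.comp κ) := e.symm.injective.comp hκ
    have : IsFreeGroup (G i) := IsFreeGroup.ofMulEquiv (MonoidHom.ofInjective hinj).symm
    exact h.not_infinite_cyclic i (h.indecomposable i).nonempty_mulEquiv_int
  · have h1 := hψ j _ (hg' x hx)
    simp only [map_mul, map_inv] at h1
    calc ψ (α x) = (ψ (α g))⁻¹ * (ψ (α g) * ψ (α x) * (ψ (α g))⁻¹) * ψ (α g) := by group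
      _ = 1 := by rw [h1]; group

/-- A Grushko decomposition without freely indecomposable factors beside the base. -/
theorem isFreeProductWithFree (h : IsGrushkoDecomposition H L₀ G t) (hn : n = 0) :
    IsFreeProductWithFree L₀ t := by
  subst hn
  let φ := Coprod.lift (Coprod.lift L₀.subtype (CoprodI.lift fun i => (G i).subtype))
    (FreeGroup.lift t)
  let ι : Coprod L₀ (FreeGroup (Fin r)) →*
      Coprod (Coprod L₀ (CoprodI fun i => G i)) (FreeGroup (Fin r)) :=
    Coprod.map Coprod.inl (MonoidHom.id _)
  let κ : Coprod (Coprod L₀ (CoprodI fun i => G i)) (FreeGroup (Fin r)) →*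
      Coprod L₀ (FreeGroup (Fin r)) :=
    Coprod.map Coprod.fst (MonoidHom.id _)
  have hι : φ.comp ι = Coprod.lift L₀.subtype (FreeGroup.lift t) :=
    Coprod.hom_ext (by ext; simp [φ, ι]) (by ext; simp [φ, ι])
  have hκι : κ.comp ι = MonoidHom.id _ :=
    Coprod.hom_ext (by ext; simp [κ, ι]) (by ext; simp [κ, ι])
  have hικ : ι.comp κ = MonoidHom.id _ :=
    Coprod.hom_ext (Coprod.hom_ext (by ext; simp [κ, ι]) (CoprodI.ext_hom _ _ fun i => i.elim0))
      (by ext; simp [κ, ι])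
  have hbij : Function.Bijective ι :=
    ⟨Function.LeftInverse.injective (g := κ) fun x => DFunLike.congr_fun hκι x,
      Function.RightInverse.surjective (g := κ) fun x => DFunLike.congr_fun hικ x⟩
  unfold IsFreeProductWithFree
  rw [← hι]
  exact h.bijective.comp hbij

end IsGrushkoDecomposition

/-! ### Varieties and homomorphisms to the base group -/

section Points

variable {Γ : Type*} [Group Γ] {d : ℕ}

@[simp]
theorem evalAt_inl (v : Fin d → Γ) (γ : Γ) : evalAt v (Coprod.inl γ) = γ := by
  simp [evalAt]

@[simp]
theorem evalAt_inr_of (v : Fin d → Γ) (j : Fin d) :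
    evalAt v (Coprod.inr (FreeGroup.of j)) = v j := by
  simp [evalAt]

theorem words_hom_ext {M : Type*} [Monoid M] {f g : Words Γ d →* M}
    (h1 : ∀ γ, f (Coprod.inl γ) = g (Coprod.inl γ))
    (h2 : ∀ j, f (Coprod.inr (FreeGroup.of j)) = g (Coprod.inr (FreeGroup.of j))) : f = g :=
  Coprod.hom_ext (MonoidHom.ext h1) (FreeGroup.ext_hom _ _ h2)

variable {M : Type*} [Group M] (π : Words Γ d →* M)

/-- The variety of `Γ`-homomorphisms to `Γ` from a quotient of the group of words. -/
def homVariety : Set (Fin d → Γ) :=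
  varietyOf {w | π w = 1}

variable {π}

theorem exists_hom_of_mem (hπ : Function.Surjective π) {v : Fin d → Γ} (hv : v ∈ homVariety π) :
    ∃ φ : M →* Γ, ∀ w, φ (π w) = evalAt v w :=
  ⟨MonoidHom.liftOfSurjective π hπ ⟨evalAt v, fun w hw => hv w hw⟩, fun w => by
    simp [MonoidHom.liftOfSurjective]⟩

theorem evalAt_of_hom (φ : M →* Γ) (hφ : ∀ γ, φ (π (Coprod.inl γ)) = γ) (w : Words Γ d) :
    evalAt (fun j => φ (π (Coprod.inr (FreeGroup.of j)))) w = φ (π w) :=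
  DFunLike.congr_fun (words_hom_ext (f := evalAt _) (g := φ.comp π) (fun γ => by simp [hφ])
    fun j => by simp) w

theorem mem_of_hom (φ : M →* Γ) (hφ : ∀ γ, φ (π (Coprod.inl γ)) = γ) :
    (fun j => φ (π (Coprod.inr (FreeGroup.of j)))) ∈ homVariety π := by
  intro w hw
  rw [evalAt_of_hom φ hφ, show π w = 1 from hw, map_one]

/-- If the `Γ`-homomorphisms to `Γ` separate the points of `M`, then `M` is the coordinate group of
the corresponding variety. -/
theorem exists_mulEquiv_functionGroup (hπ : Function.Surjective π)
    (hsep : ∀ m : M, m ≠ 1 → ∃ φ : M →* Γ, (∀ γ, φ (π (Coprod.inl γ)) = γ) ∧ φ m ≠ 1) :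
    ∃ e : M ≃* functionGroup (homVariety π), ∀ w, (e (π w) : homVariety π → Γ) =
      wordMap (homVariety π) w := by
  have hker : π.ker = (wordMap (homVariety π)).rangeRestrict.ker := by
    ext w
    rw [MonoidHom.ker_rangeRestrict, MonoidHom.mem_ker, MonoidHom.mem_ker]
    constructor
    · intro hw
      funext v
      exact v.2 w hw
    · intro hw
      by_contra hne
      obtain ⟨φ, hφ, h1⟩ := hsep _ hne
      refine h1 ?_
      rw [← evalAt_of_hom φ hφ]
      exact congrFun hw ⟨_, mem_of_hom φ hφ⟩
  let e := ((QuotientGroup.quotientKerEquivOfSurjective π hπ).symm.trans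
    (QuotientGroup.quotientMulEquivOfEq hker)).trans
    (QuotientGroup.quotientKerEquivOfSurjective _
      (wordMap (homVariety π)).rangeRestrict_surjective)
  refine ⟨e, fun w => ?_⟩
  have h1 : (QuotientGroup.quotientKerEquivOfSurjective π hπ).symm (π w) = (w : Words Γ d ⧸ π.ker) := by
    rw [MulEquiv.symm_apply_eq]
    rfl
  simp only [e, MulEquiv.trans_apply, h1]
  rfl

/-- The variety of `Γ`-homomorphisms is homogeneous if these are permuted transitively by the
`Γ`-automorphisms. -/
theorem isHomogeneous_homVariety (hπ : Function.Surjective π)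
    (h : ∀ φ ψ : M →* Γ, (∀ γ, φ (π (Coprod.inl γ)) = γ) → (∀ γ, ψ (π (Coprod.inl γ)) = γ) →
      ∃ β : M ≃* M, (∀ γ, β (π (Coprod.inl γ)) = π (Coprod.inl γ)) ∧ ∀ m, φ (β m) = ψ m) :
    IsHomogeneous (homVariety π) := by
  choose Φ hΦ using fun v : homVariety π => exists_hom_of_mem hπ v.2
  have hΦΓ : ∀ v γ, Φ v (π (Coprod.inl γ)) = γ := fun v γ => by simp [hΦ]
  have hext : ∀ (v : homVariety π) (φ : M →* Γ),
      (∀ w, evalAt (v : Fin d → Γ) w = φ (π w)) → Φ v = φ := by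
    intro v φ hφ
    ext m
    obtain ⟨w, rfl⟩ := hπ m
    rw [hΦ, hφ]
  -- Under the identification of points with homomorphisms over Γ, this is precomposition with `β`.
  let T : ∀ β : M ≃* M, (∀ γ, β (π (Coprod.inl γ)) = π (Coprod.inl γ)) →
      homVariety π → homVariety π := fun β hβ v =>
    ⟨fun j => (Φ v).comp β.toMonoidHom (π (Coprod.inr (FreeGroup.of j))),
      mem_of_hom _ fun γ => by
        change Φ v (β _) = γ
        rw [hβ, hΦΓ]⟩
  have hT : ∀ β hβ v, Φ (T β hβ v) = (Φ v).comp β.toMonoidHom := by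
    intro β hβ v
    refine hext _ _ fun w => evalAt_of_hom _ (fun γ => ?_) w
    change Φ v (β _) = γ
    rw [hβ, hΦΓ]
  have hpt : ∀ v w : homVariety π, Φ v = Φ w → v = w := by
    intro v w hvw
    apply Subtype.ext
    funext j
    rw [← evalAt_inr_of (v : Fin d → Γ) j, ← evalAt_inr_of (w : Fin d → Γ) j, ← hΦ, ← hΦ, hvw]
  have halg : ∀ β hβ, IsAlgebraicMap (T β hβ) := by
    intro β hβ
    choose b hb using fun j => hπ (β (π (Coprod.inr (FreeGroup.of j))))
    refine ⟨b, fun v j => ?_⟩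
    rw [← hΦ, hb]
    rfl
  intro x y
  obtain ⟨β, hβ, hxy⟩ := h (Φ x) (Φ y) (hΦΓ x) (hΦΓ y)
  have hβ' : ∀ γ, β.symm (π (Coprod.inl γ)) = π (Coprod.inl γ) := fun γ => by
    rw [MulEquiv.symm_apply_eq, hβ]
  refine ⟨⟨T β hβ, T β.symm hβ', fun v => hpt _ _ ?_, fun v => hpt _ _ ?_⟩, halg β hβ, halg β.symm hβ',
    hpt _ _ ?_⟩
  · ext m
    simp [hT]
  · ext m
    simp [hT]
  · change Φ (T β hβ x) = _
    ext m
    rw [hT β hβ]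
    exact hxy m

end Points

/-! ### Coordinate groups, their points and their automorphisms -/

section FunctionGroup

variable {Γ : Type*} [Group Γ] {d : ℕ} {V : Set (Fin d → Γ)}

/-- Evaluation at a point of a variety. -/
def evalPoint (v : V) : functionGroup V →* Γ :=
  (Pi.evalMonoidHom (fun _ : V => Γ) v).comp (functionGroup V).subtype

theorem evalPoint_constFun (v : V) (γ : Γ) : evalPoint v (constFun V γ) = γ :=
  constFun_apply V γ v

theorem exists_evalPoint_ne_one {f : functionGroup V} (hf : f ≠ 1) : ∃ v, evalPoint v f ≠ 1 := by
  by_contra! h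
  exact hf (Subtype.ext (funext h))

/-- The homomorphisms to `Γ` which are the identity on constants are the evaluations at points. -/
theorem exists_eq_evalPoint (hV : IsVariety V) (φ : functionGroup V →* Γ)
    (hφ : ∀ γ, φ (constFun V γ) = γ) : ∃ v : V, φ = evalPoint v := by
  obtain ⟨E, rfl⟩ := hV
  let π := (wordMap (varietyOf E)).rangeRestrict
  have hv := mem_of_hom (π := π) φ hφ
  have hvE : (fun j => φ (π (Coprod.inr (FreeGroup.of j)))) ∈ varietyOf E := by
    intro w hw
    refine hv w ?_
    apply Subtype.ext
    funext v
    exact v.2 w hw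
  refine ⟨⟨_, hvE⟩, ?_⟩
  ext f
  obtain ⟨w, rfl⟩ := (wordMap (varietyOf E)).rangeRestrict_surjective f
  exact (evalAt_of_hom (π := π) φ hφ w).symm

theorem IsAlgebraicMap.comp_mem {F : V → V} (hF : IsAlgebraicMap F) (f : functionGroup V) :
    (f : V → Γ) ∘ F ∈ functionGroup V := by
  obtain ⟨_, w, rfl⟩ := f
  obtain ⟨b, hb⟩ := hF
  refine ⟨Coprod.lift Coprod.inl (FreeGroup.lift b) w, ?_⟩
  funext v
  have h1 : (evalAt (v : Fin d → Γ)).comp (Coprod.lift Coprod.inl (FreeGroup.lift b))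
      = evalAt (F v : Fin d → Γ) :=
    words_hom_ext (fun γ => by simp) fun j => by simp [hb]
  exact DFunLike.congr_fun h1 w

/-- In a homogeneous variety, the automorphisms of the coordinate group fixing the constants permute
the points transitively. -/
theorem IsHomogeneous.exists_mulEquiv (hV : IsHomogeneous V) (x y : V) :
    ∃ α : functionGroup V ≃* functionGroup V, (∀ g ∈ constants V, α g = g) ∧
      ∀ f, evalPoint x (α f) = evalPoint y f := by
  obtain ⟨F, hF, hF', rfl⟩ := hV x y
  refine ⟨{ toFun := fun f => ⟨_, hF.comp_mem f⟩
            invFun := fun f => ⟨_, hF'.comp_mem f⟩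
            left_inv := fun f => Subtype.ext (funext fun v => by simp)
            right_inv := fun f => Subtype.ext (funext fun v => by simp)
            map_mul' := fun f g => rfl }, ?_, fun f => rfl⟩
  rintro _ ⟨γ, rfl⟩
  apply Subtype.ext
  funext v
  exact (constFun_apply V γ (F v)).trans (constFun_apply V γ v).symm

theorem isTorsionFreeGroup_functionGroup (htf : IsTorsionFreeGroup Γ) :
    IsTorsionFreeGroup (functionGroup V) := by
  intro f hf hfin
  obtain ⟨v, hv⟩ := exists_evalPoint_ne_one hf
  exact htf _ hv ((evalPoint v).isOfFinOrder hfin)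

theorem fg_functionGroup [hΓ : Group.FG Γ] : Group.FG (functionGroup V) := by
  have h1 : (⊤ : Subgroup (Words Γ d)).FG := by
    rw [← Coprod.range_inl_sup_range_inr]
    exact Subgroup.FG.sup ((Group.fg_iff_subgroup_fg _).1 inferInstance)
      ((Group.fg_iff_subgroup_fg _).1 inferInstance)
  have : Group.FG (Words Γ d) := ⟨h1⟩
  infer_instance

theorem IsHyperbolic.fg (h : IsHyperbolic Γ) : Group.FG Γ := by
  obtain ⟨S, hS, -⟩ := h
  exact ⟨⟨S, hS⟩⟩

theorem nontrivial_of_not_isElementary (h : ¬ IsElementary Γ) : Nontrivial Γ := by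
  by_contra hn
  rw [not_nontrivial_iff_subsingleton] at hn
  exact h ⟨⊤, inferInstance, inferInstance⟩

theorem constants_ne_bot [Nontrivial Γ] (hV : V.Nonempty) : constants V ≠ ⊥ := by
  obtain ⟨v, hv⟩ := hV
  obtain ⟨γ, hγ⟩ := exists_ne (1 : Γ)
  intro h
  have h1 : constFun V γ ∈ constants V := ⟨γ, rfl⟩
  rw [h, Subgroup.mem_bot] at h1
  refine hγ ?_
  rw [← evalPoint_constFun ⟨v, hv⟩ γ, h1, map_one]

/-- A retract of the coordinate group of an irreducible variety is the coordinate group of an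
irreducible variety. -/
theorem isIrreducibleVariety_homVariety (hV : IsIrreducibleVariety V)
    {L₀ : Subgroup (functionGroup V)} {π : Words Γ d →* L₀}
    (hπΓ : ∀ γ, (π (Coprod.inl γ) : functionGroup V) = constFun V γ) :
    IsIrreducibleVariety (homVariety π) := by
  obtain ⟨⟨E, hE⟩, ⟨v₀, hv₀⟩, hirr⟩ := hV
  let res : V → (L₀ →* Γ) := fun v => (evalPoint v).comp L₀.subtype
  have hres : ∀ v γ, res v (π (Coprod.inl γ)) = γ := by
    intro v γ
    change evalPoint v (π (Coprod.inl γ) : functionGroup V) = γ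
    rw [hπΓ, evalPoint_constFun]
  refine ⟨⟨_, rfl⟩, ⟨_, mem_of_hom (res ⟨v₀, hv₀⟩) (hres _)⟩, ?_⟩
  rintro ⟨n, W, hW, hcover⟩
  -- Otherwise every equation of `W i` would lie in the kernel of `π`, and `W i` would be the whole
  -- variety.
  have hword : ∀ i, ∃ w, (∀ x ∈ W i, evalAt x w = 1) ∧ π w ≠ 1 := by
    intro i
    obtain ⟨⟨Ei, hEi⟩, hss⟩ := hW i
    by_contra! hcon
    refine hss.2 fun x hx => ?_
    rw [hEi]
    intro w hw
    refine hx w (hcon w fun y hy => ?_)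
    rw [hEi] at hy
    exact hy w hw
  choose w hw hw1 using hword
  choose u hu using fun i => (π (w i) : functionGroup V).2
  have hueval : ∀ i (v : V), evalAt (v : Fin d → Γ) (u i) = res v (π (w i)) := fun i v =>
    congrFun (hu i) v
  -- Adding the equation `u i` to those of `V` gives a proper subvariety, since the function it
  -- defines, π (w i), is not constantly 1. These cover `V` because each point restricts to a point
  -- of some `W i`.
  refine hirr ⟨n, fun i => varietyOf (insert (u i) E), fun i => ⟨⟨_, rfl⟩, ?_, ?_⟩, ?_⟩
  · intro x hx
    rw [hE]
    exact fun w hw => hx w (Set.mem_insert_of_mem _ hw)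
  · intro hsub
    have hne : (π (w i) : functionGroup V) ≠ 1 := fun h => hw1 i (Subtype.ext h)
    obtain ⟨v, hv⟩ := exists_evalPoint_ne_one hne
    refine hv ?_
    have h1 := hsub v.2 (u i) (Set.mem_insert _ _)
    rw [hueval] at h1
    exact h1
  · refine Set.Subset.antisymm (fun v hv => ?_) (Set.iUnion_subset fun i x hx => ?_)
    · have h1 := mem_of_hom (res ⟨v, hv⟩) (hres _)
      rw [hcover] at h1
      obtain ⟨i, hi⟩ := Set.mem_iUnion.1 h1
      refine Set.mem_iUnion.2 ⟨i, ?_⟩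
      intro w' hw'
      rcases Set.mem_insert_iff.1 hw' with rfl | hw'
      · rw [hueval i ⟨v, hv⟩, ← evalAt_of_hom _ (hres _)]
        exact hw i _ hi
      · rw [hE] at hv
        exact hv w' hw'
    · rw [hE]
      exact fun w hw => hx w (Set.mem_insert_of_mem _ hw)

/-- In a Grushko decomposition, relative to the constants, of the coordinate group of a homogeneous
variety, all freely indecomposable factors but the base are infinite cyclic. -/
theorem IsGrushkoDecomposition.eq_zero (hV : IsVariety V) (hhom : IsHomogeneous V)
    (hne : constants V ≠ ⊥) {L₀ : Subgroup (functionGroup V)} {n r : ℕ}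
    {G : Fin n → Subgroup (functionGroup V)} {t : Fin r → functionGroup V}
    (h : IsGrushkoDecomposition (constants V) L₀ G t) : n = 0 := by
  by_contra hn
  let i : Fin n := ⟨0, Nat.pos_of_ne_zero hn⟩
  have := h.nontrivial i
  obtain ⟨g, hg⟩ := exists_ne (1 : G i)
  obtain ⟨v, hv⟩ := exists_evalPoint_ne_one (f := (g : functionGroup V)) fun h1 =>
    hg (Subtype.ext h1)
  obtain ⟨ρ, hρ, hρ'⟩ := h.isFreeFamily.exists_lift_single none L₀.subtype
  -- The point `v'` agrees with `v` on `L₀` and sends all other factors to 1; homogeneity moves it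
  -- to `v`, where `g` is nontrivial.
  obtain ⟨v', hv'⟩ := exists_eq_evalPoint hV ((evalPoint v).comp ρ) fun γ => by
    have h1 : ρ (constFun V γ) = constFun V γ := hρ ⟨_, h.le ⟨γ, rfl⟩⟩
    rw [MonoidHom.comp_apply, h1, evalPoint_constFun]
  obtain ⟨α, hα, hαv⟩ := hhom.exists_mulEquiv v' v
  refine hv ?_
  rw [← hαv]
  refine h.map_eq_one hne α hα (evalPoint v') (fun j x hx => ?_) i g.2
  rw [← hv', MonoidHom.comp_apply, hρ' (some (some j)) (by simp) x hx, map_one]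

/-- The base of a Grushko decomposition, relative to the constants, of the coordinate group of a
homogeneous irreducible variety is the coordinate group of such a variety. -/
theorem IsGrushkoDecomposition.exists_variety (hV : IsIrreducibleVariety V)
    (hhom : IsHomogeneous V) (hne : constants V ≠ ⊥) {L₀ : Subgroup (functionGroup V)} {n r : ℕ}
    {G : Fin n → Subgroup (functionGroup V)} {t : Fin r → functionGroup V}
    (h : IsGrushkoDecomposition (constants V) L₀ G t) (hΓ : constants V ≤ L₀) :
    ∃ W : Set (Fin d → Γ), IsIrreducibleVariety W ∧ IsHomogeneous W ∧
      ∃ e : L₀ ≃* functionGroup W, ∀ γ : Γ, e ⟨constFun V γ, hΓ ⟨γ, rfl⟩⟩ = constFun W γ := by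
  obtain ⟨ρ, hρ, -⟩ := h.isFreeFamily.exists_lift_single none (MonoidHom.id L₀)
  replace hρ : ∀ x : L₀, ρ x = x := hρ
  -- The retraction makes `L₀` a quotient of the words in the same `d` variables, so W can be taken
  -- in the same affine space as V.
  let π : Words Γ d →* L₀ := ρ.comp (wordMap V).rangeRestrict
  have hπ : Function.Surjective π := by
    intro x
    obtain ⟨w, hw⟩ := (wordMap V).rangeRestrict_surjective x
    exact ⟨w, by rw [MonoidHom.comp_apply, hw, hρ]⟩
  have hπΓ : ∀ γ, π (Coprod.inl γ) = ⟨constFun V γ, hΓ ⟨γ, rfl⟩⟩ := fun γ => hρ ⟨_, _⟩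
  refine ⟨homVariety π, isIrreducibleVariety_homVariety hV fun γ => by rw [hπΓ],
    isHomogeneous_homVariety hπ fun φ ψ hφ hψ => ?_, ?_⟩
  · have hext : ∀ φ : L₀ →* Γ, (∀ γ, φ (π (Coprod.inl γ)) = γ) →
        ∃ v : V, φ.comp ρ = evalPoint v := fun φ hφ => exists_eq_evalPoint hV.1 _ hφ
    obtain ⟨x, hx⟩ := hext φ hφ
    obtain ⟨y, hy⟩ := hext ψ hψ
    obtain ⟨α, hα, hαxy⟩ := hhom.exists_mulEquiv x y
    have hα' : ∀ g ∈ constants V, α.symm g = g := fun g hg => by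
      rw [MulEquiv.symm_apply_eq, hα g hg]
    -- Both the automorphism and its inverse preserve `L₀`, so the restriction is bijective.
    let β : L₀ ≃* L₀ :=
      { toFun := fun m => ⟨α m, h.map_mem hne α hα m.2⟩
        invFun := fun m => ⟨α.symm m, h.map_mem hne α.symm hα' m.2⟩
        left_inv := fun m => Subtype.ext (α.symm_apply_apply m)
        right_inv := fun m => Subtype.ext (α.apply_symm_apply m)
        map_mul' := fun a b => Subtype.ext (map_mul α (a : functionGroup V) b) }
    refine ⟨β, fun γ => ?_, fun m => ?_⟩
    · rw [hπΓ]
      exact Subtype.ext (hα _ ⟨γ, rfl⟩)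
    · have h1 := hαxy m
      rw [← hx, ← hy, MonoidHom.comp_apply, MonoidHom.comp_apply, hρ] at h1
      rw [← h1]
      exact congrArg φ (hρ (β m)).symm
  · obtain ⟨e, he⟩ := exists_mulEquiv_functionGroup hπ fun m hm => by
      obtain ⟨v, hv⟩ := exists_evalPoint_ne_one (f := (m : functionGroup V)) fun h1 =>
        hm (Subtype.ext h1)
      refine ⟨(evalPoint v).comp L₀.subtype, fun γ => ?_, hv⟩
      rw [hπΓ]
      exact evalPoint_constFun v γ
    refine ⟨e, fun γ => Subtype.ext ?_⟩
    rw [← hπΓ, he]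
    rfl

end FunctionGroup

end GroupVar

theorem mainTheorem8 {Γ : Type*} [Group Γ] (hhyp : GroupVar.IsHyperbolic Γ)
    (htf : GroupVar.IsTorsionFreeGroup Γ) (hne : ¬ GroupVar.IsElementary Γ)
    {d : ℕ} (V : Set (Fin d → Γ)) (hirr : GroupVar.IsIrreducibleVariety V)
    (hhom : GroupVar.IsHomogeneous V) :
    (∃ (n r : ℕ) (L₀ : Subgroup (GroupVar.functionGroup V))
      (G : Fin n → Subgroup (GroupVar.functionGroup V)) (t : Fin r → GroupVar.functionGroup V),
      GroupVar.IsGrushkoDecomposition (GroupVar.constants V) L₀ G t) ∧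
    ∀ (n r : ℕ) (L₀ : Subgroup (GroupVar.functionGroup V))
      (G : Fin n → Subgroup (GroupVar.functionGroup V)) (t : Fin r → GroupVar.functionGroup V),
      GroupVar.IsGrushkoDecomposition (GroupVar.constants V) L₀ G t →
        n = 0 ∧ GroupVar.IsFreeProductWithFree L₀ t ∧
        ∃ hΓ : GroupVar.constants V ≤ L₀,
          ∃ (d' : ℕ) (W : Set (Fin d' → Γ)),
            GroupVar.IsIrreducibleVariety W ∧ GroupVar.IsHomogeneous W ∧
            ∃ e : L₀ ≃* GroupVar.functionGroup W,
              ∀ γ : Γ, e ⟨GroupVar.constFun V γ, hΓ ⟨γ, rfl⟩⟩ = GroupVar.constFun W γ := by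
  have := hhyp.fg
  have := GroupVar.nontrivial_of_not_isElementary hne
  have := GroupVar.fg_functionGroup (V := V)
  have hbot := GroupVar.constants_ne_bot hirr.2.1
  refine ⟨GroupVar.exists_isGrushkoDecomposition
    (GroupVar.isTorsionFreeGroup_functionGroup htf) hbot, fun n r L₀ G t h => ?_⟩
  have hn := h.eq_zero hirr.1 hhom hbot
  exact ⟨hn, h.isFreeProductWithFree hn, h.le, d, h.exists_variety hirr hhom hbot h.le⟩
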